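/- \textbf{Model.} Let $\kappa(x,y)=c_0/(|x-y|^{\Delta}+c_1)$ on $[0,1]^2$, with constants $0<c_0\le c_1$ and $\Delta>1$ (so $\kappa$ takes values in $(0,1]$), and let $\mathcal D$ be a probability distribution on $[0,1]$ with cdf $F$. For integers $n,m$ let $x_1,\dots,x_n$ (influencers) and $y_1,\dots,y_m$ (followers) be i.i.d. with law $\mathcal D$. Given these positions, let $B\in\{0,1\}^{m\times n}$ have independent entries with $\Pr[B_{j,i}=1]=\kappa(y_j,x_i)/n$. Let $A$ be $B^{\mathsf T}B$ with its diagonal entries set to $0$, and let $M\in\mathbb R^{n\times n}$ have entries $M_{i,i'}=\mu(x_i,x_{i'})$, where $\mu(x,x')=\int\kappa(x,z)\kappa(z,x')\,dF(z)$. Let $\|\cdot\|$ be the spectral norm. \textbf{Lemma.} There is an absolute constant $c'>0$ with the following property. For all $c_0,c_1,\Delta,\mathcal D$ as above there is a constant $C>0$ such that, for every $c\ge c'$ and every sequence $m=m(n)$ of natural numbers with $m=\Omega(n\log^{c}n)$ and $m=O(n\log^{k}n)$ for some constant $k$, we have $$\left\|\frac nm A-\frac1n M\right\|\le C\left(\frac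 nm\right)^{1/4}$$ with high probability, i.e., for every real $a$ and all sufficiently large $n$ (depending on $a$, the model and the sequence $m$) this inequality holds with probability larger than $1-n^{-a}$. -/

import Mathlib

open MeasureTheory ProbabilityTheory unitInterval
open scoped Asymptotics

namespace BipartiteModel

/-- The small-world kernel `κ(x, y) = c₀ / (|x - y| ^ Δ + c₁)` on `[0, 1]`. For `0 < c₀ ≤ c₁`
and `Δ > 1` it takes its values in `(0, 1]`. -/
noncomputable def kernel (c₀ c₁ Δ : ℝ) (x y : I) : ℝ :=
  c₀ / (|(x : ℝ) - (y : ℝ)| ^ Δ + c₁)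

/-- The square kernel `μ(x, x') = ∫ κ(x, z) κ(z, x') dF(z)`. -/
noncomputable def sqKernel (c₀ c₁ Δ : ℝ) (D : Measure I) (x x' : I) : ℝ :=
  ∫ z, kernel c₀ c₁ Δ x z * kernel c₀ c₁ Δ z x' ∂D

/-- The probability `κ(y, x) / n` that a follower at `y` interacts with an influencer at `x`,
as an element of `[0, 1]`. The projection to `[0, 1]` does nothing when `κ` has values in
`(0, 1]`, see `coe_edgeProb`. -/
noncomputable def edgeProb (c₀ c₁ Δ : ℝ) (n : ℕ) (y x : I) : I :=
  Set.projIcc 0 1 zero_le_one (kernel c₀ c₁ Δ y x / n)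

lemma kernel_mem (c₀ c₁ Δ : ℝ) (h₀ : 0 < c₀) (h₁ : c₀ ≤ c₁) (x y : I) :
    kernel c₀ c₁ Δ x y ∈ Set.Ioc (0 : ℝ) 1 := by
  have h : 0 ≤ |(x : ℝ) - (y : ℝ)| ^ Δ := by positivity
  have hp : 0 < |(x : ℝ) - (y : ℝ)| ^ Δ + c₁ := by linarith
  refine ⟨div_pos h₀ hp, ?_⟩
  rw [kernel, div_le_one hp]
  linarith

lemma coe_edgeProb (c₀ c₁ Δ : ℝ) (h₀ : 0 < c₀) (h₁ : c₀ ≤ c₁) (n : ℕ) (y x : I) :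
    (edgeProb c₀ c₁ Δ n y x : ℝ) = kernel c₀ c₁ Δ y x / n := by
  have hk := kernel_mem c₀ c₁ Δ h₀ h₁ y x
  have hmem : kernel c₀ c₁ Δ y x / n ∈ Set.Icc (0 : ℝ) 1 := by
    refine ⟨div_nonneg hk.1.le n.cast_nonneg, ?_⟩
    rcases Nat.eq_zero_or_pos n with rfl | hn
    · simp
    · exact div_le_one_of_le₀ (hk.2.trans (by exact_mod_cast hn)) n.cast_nonneg
  simp [edgeProb, Set.projIcc_of_mem zero_le_one hmem]

lemma measurable_edgeProb (c₀ c₁ Δ : ℝ) (n : ℕ) :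
    Measurable (fun p : I × I => edgeProb c₀ c₁ Δ n p.1 p.2) := by
  unfold edgeProb kernel
  refine continuous_projIcc.measurable.comp ?_
  fun_prop

/-- Given the latent positions `x` of the influencers and `y` of the followers, the edges are
independent, and the edge between follower `j` and influencer `i` is present (`true`) with
probability `κ(y_j, x_i) / n`. -/
noncomputable def edgeMeasure (c₀ c₁ Δ : ℝ) (n m : ℕ) (p : (Fin n → I) × (Fin m → I)) :
    Measure (Fin m → Fin n → Bool) :=
  Measure.pi fun j => Measure.pi fun i =>
    bernoulliMeasure true false (edgeProb c₀ c₁ Δ n (p.2 j) (p.1 i))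

instance (c₀ c₁ Δ : ℝ) (n m : ℕ) (p : (Fin n → I) × (Fin m → I)) :
    IsProbabilityMeasure (edgeMeasure c₀ c₁ Δ n m p) := by
  unfold edgeMeasure
  infer_instance

lemma measurable_bernoulliMeasure_singleton (b : Bool) :
    Measurable fun q : I => bernoulliMeasure true false q {b} := by
  have ht : Measurable (toNNReal : I → NNReal) := measurable_subtype_coe.subtype_mk
  have hs : Measurable (fun q : I => toNNReal (σ q)) :=
    ht.comp continuous_symm.measurable
  simp only [bernoulliMeasure_def, Measure.add_apply, Measure.smul_apply]
  exact ((ht.coe_nnreal_ennreal.mul_const _).add (hs.coe_nnreal_ennreal.mul_const _))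

lemma measurable_edgeMeasure (c₀ c₁ Δ : ℝ) (n m : ℕ) :
    Measurable (edgeMeasure c₀ c₁ Δ n m) := by
  have hm : ∀ (b : Bool) (j : Fin m) (i : Fin n),
      Measurable fun p : (Fin n → I) × (Fin m → I) =>
        bernoulliMeasure true false (edgeProb c₀ c₁ Δ n (p.2 j) (p.1 i)) {b} := by
    intro b j i
    have h1 : Measurable fun p : (Fin n → I) × (Fin m → I) => (p.2 j, p.1 i) := by fun_prop
    have h2 := (measurable_edgeProb c₀ c₁ Δ n).comp h1
    have h3 := (measurable_bernoulliMeasure_singleton b).comp h2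
    simpa only [Function.comp_def] using h3
  have hs : ∀ (s : Set (Fin m → Fin n → Bool)) (p : (Fin n → I) × (Fin m → I)),
      edgeMeasure c₀ c₁ Δ n m p s = ∑ b ∈ s.toFinite.toFinset, ∏ j, ∏ i,
        bernoulliMeasure true false (edgeProb c₀ c₁ Δ n (p.2 j) (p.1 i)) {b j i} := by
    intro s p
    conv_lhs => rw [← s.toFinite.coe_toFinset, ← sum_measure_singleton]
    simp only [edgeMeasure, Measure.pi_singleton]
  refine Measure.measurable_of_measurable_coe _ fun s _ => ?_
  simp only [hs]
  exact Finset.measurable_sum _ fun b _ => Finset.measurable_prod _ fun j _ =>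
    Finset.measurable_prod _ fun i _ => hm (b j i) j i

/-- The conditional law of the edges given the latent positions. -/
noncomputable def edgeKernel (c₀ c₁ Δ : ℝ) (n m : ℕ) :
    Kernel ((Fin n → I) × (Fin m → I)) (Fin m → Fin n → Bool) where
  toFun := edgeMeasure c₀ c₁ Δ n m
  measurable' := measurable_edgeMeasure c₀ c₁ Δ n m

instance (c₀ c₁ Δ : ℝ) (n m : ℕ) : IsMarkovKernel (edgeKernel c₀ c₁ Δ n m) :=
  ⟨fun p => inferInstanceAs (IsProbabilityMeasure (edgeMeasure c₀ c₁ Δ n m p))⟩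

/-- The joint law of the bipartite model with `n` influencers and `m` followers: the positions
`x_1, …, x_n, y_1, …, y_m` are i.i.d. with law `D`, and given them the edges are drawn from
`edgeKernel`. A sample point is `((x, y), b)`. -/
noncomputable def law (c₀ c₁ Δ : ℝ) (D : Measure I) (n m : ℕ) :
    Measure (((Fin n → I) × (Fin m → I)) × (Fin m → Fin n → Bool)) :=
  ((Measure.pi fun _ => D).prod (Measure.pi fun _ => D)) ⊗ₘ edgeKernel c₀ c₁ Δ n m

instance (c₀ c₁ Δ : ℝ) (D : Measure I) [IsProbabilityMeasure D] (n m : ℕ) :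
    IsProbabilityMeasure (law c₀ c₁ Δ D n m) := by
  unfold law
  infer_instance

/-- The `m × n` follower–influencer adjacency matrix `B`. -/
def adjMatrix {n m : ℕ} (b : Fin m → Fin n → Bool) : Matrix (Fin m) (Fin n) ℝ :=
  Matrix.of fun j i => if b j i then 1 else 0

/-- `A`: the matrix `Bᵀ B` with its diagonal set to zero. -/
def coMatrix {n m : ℕ} (b : Fin m → Fin n → Bool) : Matrix (Fin n) (Fin n) ℝ :=
  Matrix.of fun i i' =>
    if i = i' then 0 else ((adjMatrix b).transpose * adjMatrix b) i i'

/-- `M`: the Gram matrix `M i i' = μ(x_i, x_{i'})`. -/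
noncomputable def gramMatrix (c₀ c₁ Δ : ℝ) (D : Measure I) {n : ℕ} (x : Fin n → I) :
    Matrix (Fin n) (Fin n) ℝ :=
  Matrix.of fun i i' => sqKernel c₀ c₁ Δ D (x i) (x i')

/-- The spectral norm of a square real matrix: the operator norm on Euclidean space. -/
noncomputable def specNorm {n : ℕ} (X : Matrix (Fin n) (Fin n) ℝ) : ℝ :=
  ‖Matrix.toEuclideanCLM (n := Fin n) (𝕜 := ℝ) X‖

end BipartiteModel

/-!
Given the positions of the influencers, the rows of `B` are independent sparse `0`-`1` vectors, and
`A` is the sum of the off-diagonal parts of their Gram matrices. The conditional mean of `(n / m) A`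
is `(1 / n) M` without its diagonal, which costs at most `1 / n ≤ (n / m) ^ (1 / 4)`, so it remains
to show that a sum `S = ∑ j, (Z j - E (Z j))`, with independent symmetric `Z j`, concentrates.

This is done by the method of exchangeable pairs. Replacing the `j`-th summand of `S` by an
independent copy gives `T` such that `(S, T)` and `(T, S)` have the same law, hence
`2 * E tr ((Z j - E (Z j)) * S ^ (2p - 1)) = E tr ((S - T) * (S ^ (2p - 1) - T ^ (2p - 1)))`, and
a trace form of the mean value theorem bounds this by a multiple of
`E tr ((S - T) ^ 2 * S ^ (2p - 2))`. Summing over `j` and applying Young's inequality,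
`E tr (S ^ (2p)) ≤ n * (8p) ^ p * E (v ^ p)` for any random `v` with `∑ j, Z j ^ 2 ≤ v` in the
Loewner order. For the Gram matrices of `0`-`1` rows one may take the squared largest row degree
times the largest column degree of `B`, and its moments follow from exponential moments of the
degrees. Markov's inequality with `p = ⌈log n⌉` bounds the failure probability by a polynomial in
`n` times `(216 * p ^ 4 * √(n / m)) ^ p`, which is smaller than any power of `n` once `c > 8`.
-/

namespace BipartiteModel

open Matrix
open scoped MatrixOrder Matrix.Norms.L2Operator

section PowerInequalities

lemma pow_mul_pow_le_add {x y : ℝ} (hx : 0 ≤ x) (hy : 0 ≤ y) (a b : ℕ) :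
    x ^ a * y ^ b ≤ x ^ (a + b) + y ^ (a + b) := by
  rcases le_total x y with h | h
  · calc x ^ a * y ^ b ≤ y ^ a * y ^ b := by gcongr
      _ = y ^ (a + b) := (pow_add y a b).symm
      _ ≤ x ^ (a + b) + y ^ (a + b) := le_add_of_nonneg_left (by positivity)
  · calc x ^ a * y ^ b ≤ x ^ a * x ^ b := by gcongr
      _ = x ^ (a + b) := (pow_add x a b).symm
      _ ≤ x ^ (a + b) + y ^ (a + b) := le_add_of_nonneg_right (by positivity)

lemma sub_mul_pow_sub_pow_le (x y : ℝ) (r : ℕ) :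
    (x - y) * (x ^ (2 * r + 1) - y ^ (2 * r + 1)) ≤
      (2 * r + 1) * ((x - y) ^ 2 * x ^ (2 * r) + (x - y) ^ 2 * y ^ (2 * r)) := by
  have summand_le : ∀ i ∈ Finset.range (2 * r + 1),
      x ^ i * y ^ (2 * r - i) ≤ x ^ (2 * r) + y ^ (2 * r) := fun i hi => by
    have hi : i + (2 * r - i) = 2 * r := by have := Finset.mem_range.1 hi; omega
    calc x ^ i * y ^ (2 * r - i) ≤ |x| ^ i * |y| ^ (2 * r - i) := by
          rw [← abs_pow, ← abs_pow, ← abs_mul]; exact le_abs_self _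
      _ ≤ |x| ^ (2 * r) + |y| ^ (2 * r) := by
          simpa only [hi] using pow_mul_pow_le_add (abs_nonneg x) (abs_nonneg y) i (2 * r - i)
      _ = x ^ (2 * r) + y ^ (2 * r) := by simp only [(even_two_mul r).pow_abs]
  calc (x - y) * (x ^ (2 * r + 1) - y ^ (2 * r + 1))
      = (x - y) ^ 2 * ∑ i ∈ Finset.range (2 * r + 1), x ^ i * y ^ (2 * r - i) := by
        rw [← (Commute.all x y).geom_sum₂_mul, Nat.add_sub_cancel]; ring
    _ ≤ (x - y) ^ 2 * ((2 * r + 1) * (x ^ (2 * r) + y ^ (2 * r))) := by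
        gcongr
        simpa [mul_add] using Finset.sum_le_card_nsmul _ _ _ summand_le
    _ = _ := by ring

lemma add_one_mul_mul_pow_le {x y : ℝ} (hx : 0 ≤ x) (hy : 0 ≤ y) (r : ℕ) :
    (r + 1) * (x * y ^ r) ≤ r * y ^ (r + 1) + x ^ (r + 1) := by
  induction r with
  | zero => simp
  | succ r ih =>
    have : 0 ≤ (r + 1) * (y ^ r * (y - x) ^ 2) := by positivity
    push_cast
    linear_combination this + mul_le_mul_of_nonneg_left ih hx

end PowerInequalities

section RealSymmetric

variable {ι : Type*} [Fintype ι] [DecidableEq ι] {S T : Matrix ι ι ℝ}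

lemma pow_eq_eigenvectorUnitary_mul (hS : S.IsHermitian) (a : ℕ) :
    S ^ a = hS.eigenvectorUnitary * diagonal (hS.eigenvalues ^ a) *
      star (hS.eigenvectorUnitary : Matrix ι ι ℝ) := by
  conv_lhs => rw [hS.spectral_theorem, ← map_pow, diagonal_pow, Unitary.conjStarAlgAut_apply]
  rfl

lemma trace_pow_eq_sum_eigenvalues (hS : S.IsHermitian) (a : ℕ) :
    (S ^ a).trace = ∑ i, hS.eigenvalues i ^ a := by
  rw [pow_eq_eigenvectorUnitary_mul hS, trace_mul_cycle, Unitary.coe_star_mul_self,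
    Matrix.one_mul, trace_diagonal]
  rfl

/-- The matrix of `A` relative to an orthonormal eigenbasis of `S` on the left and one of `T` on
the right. In these coordinates multiplication by `S` on the left and by `T` on the right is
diagonal, so trace inequalities involving both `S` and `T` reduce to scalar ones. -/
noncomputable def eigenCoord (hS : S.IsHermitian) (hT : T.IsHermitian) (A : Matrix ι ι ℝ) :
    Matrix ι ι ℝ :=
  star (hS.eigenvectorUnitary : Matrix ι ι ℝ) * A * hT.eigenvectorUnitary

lemma eigenCoord_sub (hS : S.IsHermitian) (hT : T.IsHermitian) (A B : Matrix ι ι ℝ) :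
    eigenCoord hS hT (A - B) = eigenCoord hS hT A - eigenCoord hS hT B := by
  simp only [eigenCoord, Matrix.mul_sub, Matrix.sub_mul]

lemma eigenCoord_pow_mul (hS : S.IsHermitian) (hT : T.IsHermitian) (a : ℕ) (A : Matrix ι ι ℝ) :
    eigenCoord hS hT (S ^ a * A) = diagonal (hS.eigenvalues ^ a) * eigenCoord hS hT A := by
  rw [eigenCoord, pow_eq_eigenvectorUnitary_mul hS]
  simp only [← Matrix.mul_assoc, Unitary.coe_star_mul_self, Matrix.one_mul, eigenCoord]

lemma eigenCoord_mul_pow (hS : S.IsHermitian) (hT : T.IsHermitian) (a : ℕ) (A : Matrix ι ι ℝ) :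
    eigenCoord hS hT (A * T ^ a) = eigenCoord hS hT A * diagonal (hT.eigenvalues ^ a) := by
  rw [eigenCoord, pow_eq_eigenvectorUnitary_mul hT]
  simp only [Matrix.mul_assoc, Unitary.coe_star_mul_self, Matrix.mul_one, eigenCoord]

lemma eigenCoord_pow_sub_pow_apply (hS : S.IsHermitian) (hT : T.IsHermitian) (a : ℕ) (i j : ι) :
    eigenCoord hS hT (S ^ a - T ^ a) i j =
      (hS.eigenvalues i ^ a - hT.eigenvalues j ^ a) * eigenCoord hS hT 1 i j := by
  have coord_S := eigenCoord_pow_mul hS hT a 1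
  have coord_T := eigenCoord_mul_pow hS hT a 1
  rw [Matrix.mul_one] at coord_S
  rw [Matrix.one_mul] at coord_T
  simp only [eigenCoord_sub, coord_S, coord_T, Matrix.sub_apply, diagonal_mul, mul_diagonal,
    Pi.pow_apply]
  ring

lemma trace_mul_star_eq_sum (hS : S.IsHermitian) (hT : T.IsHermitian) (A B : Matrix ι ι ℝ) :
    (A * star B).trace = ∑ i, ∑ j, eigenCoord hS hT A i j * eigenCoord hS hT B i j := by
  have coord_mul : eigenCoord hS hT A * star (eigenCoord hS hT B) =
      star (hS.eigenvectorUnitary : Matrix ι ι ℝ) * (A * star B) * hS.eigenvectorUnitary := by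
    simp only [eigenCoord, star_mul, star_star]
    rw [Matrix.mul_assoc _ (hT.eigenvectorUnitary : Matrix ι ι ℝ), ← Matrix.mul_assoc _ (star _),
      Unitary.mul_star_self_of_mem hT.eigenvectorUnitary.2, Matrix.one_mul]
    simp only [Matrix.mul_assoc]
  calc (A * star B).trace = (eigenCoord hS hT A * star (eigenCoord hS hT B)).trace := by
        rw [coord_mul, trace_mul_cycle,
          Unitary.mul_star_self_of_mem hS.eigenvectorUnitary.2, Matrix.one_mul]
    _ = _ := by simp [trace, Matrix.mul_apply, star_apply]

lemma trace_sub_sq_mul_pow_add_eq_sum (hS : S.IsHermitian) (hT : T.IsHermitian) (r : ℕ) :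
    ((S - T) ^ 2 * S ^ (2 * r)).trace + ((S - T) ^ 2 * T ^ (2 * r)).trace =
      ∑ i, ∑ j, ((hS.eigenvalues i - hT.eigenvalues j) ^ 2 * hS.eigenvalues i ^ (2 * r) +
        (hS.eigenvalues i - hT.eigenvalues j) ^ 2 * hT.eigenvalues j ^ (2 * r)) *
          eigenCoord hS hT 1 i j ^ 2 := by
  have left : ((S - T) ^ 2 * S ^ (2 * r)).trace =
      ((S ^ r * (S - T)) * star (S ^ r * (S - T))).trace := by
    rw [star_mul, star_pow, hS.isSelfAdjoint.star_eq, (hS.sub hT).isSelfAdjoint.star_eq,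
      Matrix.mul_assoc, trace_mul_comm (S ^ r), two_mul, pow_add, sq]
    simp only [Matrix.mul_assoc]
  have right : ((S - T) ^ 2 * T ^ (2 * r)).trace =
      (((S - T) * T ^ r) * star ((S - T) * T ^ r)).trace := by
    rw [star_mul, star_pow, hT.isSelfAdjoint.star_eq, (hS.sub hT).isSelfAdjoint.star_eq,
      ← Matrix.mul_assoc, trace_mul_comm _ (S - T), two_mul, pow_add, sq]
    simp only [Matrix.mul_assoc]
  have coord := eigenCoord_pow_sub_pow_apply hS hT 1
  simp only [pow_one] at coord
  simp only [left, right, trace_mul_star_eq_sum hS hT, eigenCoord_pow_mul, eigenCoord_mul_pow,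
    diagonal_mul, mul_diagonal, coord, Pi.pow_apply, ← Finset.sum_add_distrib]
  exact Finset.sum_congr rfl fun i _ => Finset.sum_congr rfl fun j _ => by ring

lemma trace_sub_mul_pow_sub_pow_le (hS : S.IsHermitian) (hT : T.IsHermitian) (r : ℕ) :
    ((S - T) * (S ^ (2 * r + 1) - T ^ (2 * r + 1))).trace ≤
      (2 * r + 1) * (((S - T) ^ 2 * S ^ (2 * r)).trace + ((S - T) ^ 2 * T ^ (2 * r)).trace) := by
  have adjoint : star (S ^ (2 * r + 1) - T ^ (2 * r + 1)) = S ^ (2 * r + 1) - T ^ (2 * r + 1) :=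
    ((hS.pow _).sub (hT.pow _)).isSelfAdjoint.star_eq
  have coord := eigenCoord_pow_sub_pow_apply hS hT 1
  simp only [pow_one] at coord
  rw [trace_sub_sq_mul_pow_add_eq_sum hS hT, ← adjoint, trace_mul_star_eq_sum hS hT]
  simp only [coord, eigenCoord_pow_sub_pow_apply, Finset.mul_sum]
  refine Finset.sum_le_sum fun i _ => Finset.sum_le_sum fun j _ => ?_
  have scalar := sub_mul_pow_sub_pow_le (hS.eigenvalues i) (hT.eigenvalues j) r
  linear_combination eigenCoord hS hT 1 i j ^ 2 * scalar

lemma trace_pow_two_mul_eq_sum (hS : S.IsHermitian) (p : ℕ) :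
    (S ^ (2 * p)).trace = ∑ i, (hS.eigenvalues i ^ 2) ^ p := by
  rw [trace_pow_eq_sum_eigenvalues hS]
  simp only [pow_mul]

lemma trace_pow_two_mul_nonneg (hS : S.IsHermitian) (p : ℕ) : 0 ≤ (S ^ (2 * p)).trace := by
  rw [trace_pow_two_mul_eq_sum hS]
  positivity

lemma trace_mul_pow_two_mul_le {W : Matrix ι ι ℝ} {v : ℝ} (hS : S.IsHermitian) (hW : W ≤ v • 1)
    (r : ℕ) : (W * S ^ (2 * r)).trace ≤ v * (S ^ (2 * r)).trace := by
  have h : 0 ≤ (S ^ r * (v • 1 - W) * S ^ r).trace := by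
    simpa only [(hS.pow r).eq] using
      ((Matrix.le_iff.1 hW).conjTranspose_mul_mul_same (S ^ r)).trace_nonneg
  rw [trace_mul_cycle, ← pow_add, ← two_mul, trace_mul_comm] at h
  simpa [sub_mul, trace_sub, trace_smul] using h

lemma add_one_mul_trace_mul_pow_le {W : Matrix ι ι ℝ} {v : ℝ} (hS : S.IsHermitian) (hv : 0 ≤ v)
    (hW : W ≤ v • 1) (r : ℕ) :
    (r + 1) * (W * S ^ (2 * r)).trace ≤
      r * (S ^ (2 * (r + 1))).trace + Fintype.card ι * v ^ (r + 1) := by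
  calc (r + 1) * (W * S ^ (2 * r)).trace
      ≤ (r + 1) * (v * (S ^ (2 * r)).trace) := by
        gcongr
        exact trace_mul_pow_two_mul_le hS hW r
    _ = ∑ i, (r + 1) * (v * (hS.eigenvalues i ^ 2) ^ r) := by
        simp only [trace_pow_two_mul_eq_sum hS, Finset.mul_sum]
    _ ≤ ∑ i, (r * (hS.eigenvalues i ^ 2) ^ (r + 1) + v ^ (r + 1)) :=
        Finset.sum_le_sum fun i _ => add_one_mul_mul_pow_le hv (sq_nonneg _) r
    _ = r * (S ^ (2 * (r + 1))).trace + Fintype.card ι * v ^ (r + 1) := by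
        simp [trace_pow_two_mul_eq_sum hS, Finset.sum_add_distrib, Finset.mul_sum]

lemma l2_opNorm_eq_norm_eigenvalues (hS : S.IsHermitian) : ‖S‖ = ‖hS.eigenvalues‖ := by
  conv_lhs => rw [← pow_one S, pow_eq_eigenvectorUnitary_mul hS, ← Unitary.coe_star,
    CStarRing.norm_mul_coe_unitary, CStarRing.norm_coe_unitary_mul, pow_one, l2_opNorm_diagonal]

lemma l2_opNorm_le_of_trace_pow_le (hS : S.IsHermitian) {p : ℕ} (hp : p ≠ 0) {t : ℝ} (ht : 0 ≤ t)
    (h : (S ^ (2 * p)).trace ≤ t ^ (2 * p)) : ‖S‖ ≤ t := by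
  rw [l2_opNorm_eq_norm_eigenvalues hS, pi_norm_le_iff_of_nonneg ht]
  intro i
  refine le_of_pow_le_pow_left₀ (Nat.mul_ne_zero two_ne_zero hp) ht ?_
  calc ‖hS.eigenvalues i‖ ^ (2 * p) = (hS.eigenvalues i ^ 2) ^ p := by
        rw [pow_mul, Real.norm_eq_abs, sq_abs]
    _ ≤ ∑ i, (hS.eigenvalues i ^ 2) ^ p :=
        Finset.single_le_sum (f := fun i => (hS.eigenvalues i ^ 2) ^ p)
          (fun i _ => by positivity) (Finset.mem_univ i)
    _ ≤ t ^ (2 * p) := (trace_pow_two_mul_eq_sum hS p).symm.trans_le h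

end RealSymmetric

section Exchange

lemma integral_le_integral_of_add_comp_le {α : Type*} [MeasurableSpace α] {μ : Measure α}
    {T : α → α} (hT : MeasurePreserving T μ μ) {f g : α → ℝ} (hf : Integrable f μ)
    (hg : Integrable g μ) (h : ∀ a, f a + f (T a) ≤ g a + g (T a)) :
    ∫ a, f a ∂μ ≤ ∫ a, g a ∂μ := by
  have integral_add_comp {u : α → ℝ} (hu : Integrable u μ) :
      ∫ a, u a + u (T a) ∂μ = 2 * ∫ a, u a ∂μ := by
    have integral_comp : ∫ a, u (T a) ∂μ = ∫ a, u a ∂μ := by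
      have hTu : AEStronglyMeasurable u (μ.map T) := hT.map_eq.symm ▸ hu.1
      rw [← integral_map hT.aemeasurable hTu, hT.map_eq]
    have := integral_add hu (hT.integrable_comp_of_integrable hu)
    simp only [Function.comp_apply, integral_comp] at this
    rw [this, two_mul]
  have doubled := integral_mono (hf.add (hT.integrable_comp_of_integrable hf))
    (hg.add (hT.integrable_comp_of_integrable hg)) h
  simp only [Pi.add_apply, Function.comp_apply, integral_add_comp hf,
    integral_add_comp hg] at doubled
  linarith

lemma integrable_comp_of_norm_le {α E : Type*} [MeasurableSpace α] {μ : Measure α}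
    [IsFiniteMeasure μ] [NormedAddCommGroup E] [ProperSpace E] {f : α → E} {C : ℝ}
    (hf : AEStronglyMeasurable f μ) (hC : ∀ a, ‖f a‖ ≤ C) {g : E → ℝ} (hg : Continuous g) :
    Integrable (fun a => g (f a)) μ := by
  obtain ⟨K, hK⟩ := (isCompact_closedBall (0 : E) C).exists_bound_of_continuousOn hg.continuousOn
  exact .of_bound (hg.comp_aestronglyMeasurable hf) K
    (.of_forall fun a => hK _ (mem_closedBall_zero_iff.2 (hC a)))

lemma integral_trace_mul {α ι : Type*} [MeasurableSpace α] {μ : Measure α} [Fintype ι]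
    [DecidableEq ι] (A : Matrix ι ι ℝ) {X : α → Matrix ι ι ℝ} (hX : Integrable X μ) :
    ∫ ω, (X ω * A).trace ∂μ = ((∫ ω, X ω ∂μ) * A).trace :=
  ((traceLinearMap ι ℝ ℝ ∘ₗ LinearMap.mulRight ℝ A).toContinuousLinearMap).integral_comp_comm hX

/-- Exchanges the `j`-th coordinates of two samples. -/
def coordSwap {J Ω : Type*} [DecidableEq J] (j : J) (z : (J → Ω) × (J → Ω)) : (J → Ω) × (J → Ω) :=
  (Function.update z.1 j (z.2 j), Function.update z.2 j (z.1 j))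

lemma measurePreserving_coordSwap {J Ω : Type*} [Fintype J] [DecidableEq J] [MeasurableSpace Ω]
    (ν : J → Measure Ω) [∀ j, SigmaFinite (ν j)] (j : J) :
    MeasurePreserving (coordSwap j) ((Measure.pi ν).prod (Measure.pi ν))
      ((Measure.pi ν).prod (Measure.pi ν)) := by
  have swap_at : MeasurePreserving
      (fun (w : J → Ω × Ω) k => (if k = j then Prod.swap else id) (w k))
      (Measure.pi fun k => (ν k).prod (ν k)) (Measure.pi fun k => (ν k).prod (ν k)) :=
    measurePreserving_pi _ _ fun k => by
      split_ifs
      exacts [Measure.measurePreserving_swap, MeasurePreserving.id _]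
  have pairing := measurePreserving_arrowProdEquivProdArrow Ω Ω J ν ν
  have conj : coordSwap j = MeasurableEquiv.arrowProdEquivProdArrow Ω Ω J ∘
      (fun w k => (if k = j then Prod.swap else id) (w k)) ∘
        (MeasurableEquiv.arrowProdEquivProdArrow Ω Ω J).symm := by
    ext z k
    all_goals
      rcases eq_or_ne k j with rfl | hk
      · simp [coordSwap, MeasurableEquiv.arrowProdEquivProdArrow, Equiv.arrowProdEquivProdArrow]
      · simp [coordSwap, MeasurableEquiv.arrowProdEquivProdArrow, Equiv.arrowProdEquivProdArrow, hk]
  rw [conj]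
  exact pairing.comp (swap_at.comp pairing.symm)

lemma sq_sub_le_two_smul {ι : Type*} [Fintype ι] [DecidableEq ι] {X Y : Matrix ι ι ℝ}
    (hX : X.IsHermitian) (hY : Y.IsHermitian) :
    (X - Y) ^ 2 ≤ (2 : ℝ) • (X ^ 2 + Y ^ 2) := by
  have : (2 : ℝ) • (X ^ 2 + Y ^ 2) - (X - Y) ^ 2 = (X + Y) ^ 2 := by
    rw [two_smul]; noncomm_ring
  exact sub_nonneg.1 (this ▸ (hX.add hY).isSelfAdjoint.sq_nonneg)

lemma sum_sq_sub_le_smul_one {J Ω ι : Type*} [Fintype J] [Fintype ι] [DecidableEq ι]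
    {Z : J → Ω → Matrix ι ι ℝ} (hZ : ∀ j ω, (Z j ω).IsHermitian) {v : (J → Ω) → ℝ}
    (hv : ∀ b, ∑ j, Z j (b j) ^ 2 ≤ v b • 1) (b b' : J → Ω) :
    ∑ j, (Z j (b j) - Z j (b' j)) ^ 2 ≤ (2 * (v b + v b')) • (1 : Matrix ι ι ℝ) := by
  calc ∑ j, (Z j (b j) - Z j (b' j)) ^ 2
      ≤ ∑ j, (2 : ℝ) • (Z j (b j) ^ 2 + Z j (b' j) ^ 2) :=
        Finset.sum_le_sum fun j _ => sq_sub_le_two_smul (hZ j _) (hZ j _)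
    _ = (2 : ℝ) • (∑ j, Z j (b j) ^ 2 + ∑ j, Z j (b' j) ^ 2) := by
        rw [← Finset.smul_sum, Finset.sum_add_distrib]
    _ ≤ (2 : ℝ) • (v b • 1 + v b' • 1) :=
        smul_le_smul_of_nonneg_left (add_le_add (hv b) (hv b')) zero_le_two
    _ = (2 * (v b + v b')) • (1 : Matrix ι ι ℝ) := by rw [mul_smul, add_smul]

variable {J Ω ι : Type*} [Fintype J] [MeasurableSpace Ω] (ν : J → Measure Ω)
  [Fintype ι] [DecidableEq ι] {Z : J → Ω → Matrix ι ι ℝ}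

variable (Z) in
/-- The sum of the matrices `Z j (b j)`, each centred at its mean when `b j` has law `ν j`. -/
noncomputable def centredSum (b : J → Ω) : Matrix ι ι ℝ :=
  ∑ j, (Z j (b j) - ∫ ω, Z j ω ∂ν j)

lemma isHermitian_centredSum (hZ : ∀ j ω, (Z j ω).IsHermitian) (b : J → Ω) :
    (centredSum ν Z b).IsHermitian := by
  have isHermitian_integral (j : J) : (∫ ω, Z j ω ∂ν j).IsHermitian := by
    have h := (starL' ℝ : Matrix ι ι ℝ ≃L[ℝ] Matrix ι ι ℝ).integral_comp_comm (μ := ν j) (Z j)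
    simp only [starL'_apply, (hZ j _).isSelfAdjoint.star_eq] at h
    exact h.symm
  exact (isSelfAdjoint_sum _ fun j _ => ((hZ j _).sub (isHermitian_integral j)).isSelfAdjoint)

lemma centredSum_sub_centredSum_coordSwap [DecidableEq J] (j : J) (z : (J → Ω) × (J → Ω)) :
    centredSum ν Z z.1 - centredSum ν Z (coordSwap j z).1 = Z j (z.1 j) - Z j (z.2 j) := by
  unfold centredSum
  rw [← Finset.sum_sub_distrib, Finset.sum_eq_single j]
  · simp [coordSwap]
  · intro k _ hk
    simp [coordSwap, hk]
  · simp

lemma trace_centredSum_pow_succ (a : ℕ) (b : J → Ω) :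
    (centredSum ν Z b ^ (a + 1)).trace =
      ∑ j, ((Z j (b j) - ∫ ω, Z j ω ∂ν j) * centredSum ν Z b ^ a).trace := by
  rw [← trace_sum, ← Finset.sum_mul, pow_succ']
  rfl

lemma add_one_mul_sum_trace_sq_sub_mul_pow_le (hZ : ∀ j ω, (Z j ω).IsHermitian)
    {v : (J → Ω) → ℝ} (hv0 : ∀ b, 0 ≤ v b) (hv : ∀ b, ∑ j, Z j (b j) ^ 2 ≤ v b • 1) (r : ℕ)
    (z : (J → Ω) × (J → Ω)) :
    (r + 1) * ((2 * r + 1) *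
        ∑ j, ((Z j (z.1 j) - Z j (z.2 j)) ^ 2 * centredSum ν Z z.1 ^ (2 * r)).trace) ≤
      r * (centredSum ν Z z.1 ^ (2 * (r + 1))).trace +
        Fintype.card ι * (4 * (2 * r + 1)) ^ (r + 1) / 2 * (v z.1 ^ (r + 1) + v z.2 ^ (r + 1)) := by
  have loewner : (2 * r + 1 : ℝ) • ∑ j, (Z j (z.1 j) - Z j (z.2 j)) ^ 2 ≤
      ((2 * r + 1) * (2 * (v z.1 + v z.2))) • (1 : Matrix ι ι ℝ) := by
    rw [mul_smul]
    exact smul_le_smul_of_nonneg_left (sum_sq_sub_le_smul_one hZ hv z.1 z.2) (by positivity)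
  have young := add_one_mul_trace_mul_pow_le (isHermitian_centredSum ν hZ z.1)
    (by have := hv0 z.1; have := hv0 z.2; positivity) loewner r
  have convexity := add_pow_le (hv0 z.1) (hv0 z.2) (r + 1)
  rw [smul_mul, trace_smul, Finset.sum_mul, trace_sum, smul_eq_mul] at young
  refine young.trans (add_le_add_right ?_ _)
  calc Fintype.card ι * ((2 * r + 1) * (2 * (v z.1 + v z.2))) ^ (r + 1)
      = Fintype.card ι * (2 * (2 * r + 1)) ^ (r + 1) * (v z.1 + v z.2) ^ (r + 1) := by
        rw [mul_assoc (Fintype.card ι : ℝ), ← mul_pow]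
        ring_nf
    _ ≤ Fintype.card ι * (2 * (2 * r + 1)) ^ (r + 1) *
        (2 ^ r * (v z.1 ^ (r + 1) + v z.2 ^ (r + 1))) := by
        gcongr
        exact convexity
    _ = _ := by
        rw [show (4 : ℝ) = 2 * 2 by norm_num, mul_assoc 2 2, mul_pow 2 (2 * _), pow_succ 2 r]
        ring

variable {C : ℝ} [∀ j, IsProbabilityMeasure (ν j)]

lemma integrable_comp_sample_pair (hZm : ∀ j, StronglyMeasurable (Z j))
    (hZC : ∀ j ω, ‖Z j ω‖ ≤ C) {g : (J → Matrix ι ι ℝ) × (J → Matrix ι ι ℝ) → ℝ}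
    (hg : Continuous g) :
    Integrable (fun z : (J → Ω) × (J → Ω) => g (fun j => Z j (z.1 j), fun j => Z j (z.2 j)))
      ((Measure.pi ν).prod (Measure.pi ν)) := by
  borelize (Matrix ι ι ℝ)
  have measurable_sample : Measurable fun (b : J → Ω) j => Z j (b j) :=
    measurable_pi_lambda _ fun j => (hZm j).measurable.comp (measurable_pi_apply j)
  refine integrable_comp_of_norm_le (C := max C 0)
    ((measurable_sample.comp measurable_fst).prodMk
      (measurable_sample.comp measurable_snd)).aestronglyMeasurable (fun z => ?_) hg
  have norm_sample_le (b : J → Ω) : ‖fun j => Z j (b j)‖ ≤ max C 0 :=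
    (pi_norm_le_iff_of_nonneg (le_max_right _ _)).2 fun j => (hZC j _).trans (le_max_left _ _)
  exact max_le (norm_sample_le _) (norm_sample_le _)

lemma integrable_trace_mul_centredSum_pow (hZm : ∀ j, StronglyMeasurable (Z j))
    (hZC : ∀ j ω, ‖Z j ω‖ ≤ C) {X : (J → Matrix ι ι ℝ) × (J → Matrix ι ι ℝ) → Matrix ι ι ℝ}
    (hX : Continuous X) (a : ℕ) :
    Integrable (fun z : (J → Ω) × (J → Ω) =>
      (X (fun j => Z j (z.1 j), fun j => Z j (z.2 j)) * centredSum ν Z z.1 ^ a).trace)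
        ((Measure.pi ν).prod (Measure.pi ν)) :=
  integrable_comp_sample_pair ν hZm hZC
    (g := fun w => (X w * (∑ j, (w.1 j - ∫ ω, Z j ω ∂ν j)) ^ a).trace) (by fun_prop)

lemma integral_trace_sub_integral_mul_eq_zero (hZm : ∀ j, StronglyMeasurable (Z j))
    (hZC : ∀ j ω, ‖Z j ω‖ ≤ C) (a : ℕ) (j : J) :
    ∫ z : (J → Ω) × (J → Ω), ((Z j (z.2 j) - ∫ ω, Z j ω ∂ν j) * centredSum ν Z z.1 ^ a).trace
      ∂(Measure.pi ν).prod (Measure.pi ν) = 0 := by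
  have integrable_Z : Integrable (Z j) (ν j) :=
    .of_bound (hZm j).aestronglyMeasurable C (.of_forall (hZC j))
  have integrable_centred := integrable_Z.sub (integrable_const (∫ ω, Z j ω ∂ν j))
  rw [integral_prod _ (integrable_trace_mul_centredSum_pow ν hZm hZC
    (X := fun w => w.2 j - ∫ ω, Z j ω ∂ν j) (by fun_prop) a)]
  refine integral_eq_zero_of_ae (.of_forall fun b => ?_)
  have inner := integral_trace_mul (centredSum ν Z b ^ a)
    (integrable_comp_eval (μ := ν) integrable_centred)
  rw [integral_comp_eval integrable_centred.1] at inner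
  simpa [integral_sub integrable_Z (integrable_const _)] using inner

lemma integral_trace_coord_mul_pow_le (hZ : ∀ j ω, (Z j ω).IsHermitian)
    (hZm : ∀ j, StronglyMeasurable (Z j)) (hZC : ∀ j ω, ‖Z j ω‖ ≤ C) (r : ℕ) (j : J) :
    ∫ b, ((Z j (b j) - ∫ ω, Z j ω ∂ν j) * centredSum ν Z b ^ (2 * r + 1)).trace ∂Measure.pi ν ≤
      (2 * r + 1) * ∫ z : (J → Ω) × (J → Ω),
        ((Z j (z.1 j) - Z j (z.2 j)) ^ 2 * centredSum ν Z z.1 ^ (2 * r)).trace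
          ∂(Measure.pi ν).prod (Measure.pi ν) := by
  classical
  set P := (Measure.pi ν).prod (Measure.pi ν)
  set M := fun k => ∫ ω, Z k ω ∂ν k
  have integrable_trace_mul {X : (J → Matrix ι ι ℝ) × (J → Matrix ι ι ℝ) → Matrix ι ι ℝ}
      (hX : Continuous X) (a : ℕ) := integrable_trace_mul_centredSum_pow ν hZm hZC hX a
  calc _ = ∫ z, ((Z j (z.1 j) - M j) * centredSum ν Z z.1 ^ (2 * r + 1)).trace ∂P -
        ∫ z, ((Z j (z.2 j) - M j) * centredSum ν Z z.1 ^ (2 * r + 1)).trace ∂P := by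
        rw [integral_trace_sub_integral_mul_eq_zero ν hZm hZC, integral_fun_fst
          fun b => ((Z j (b j) - M j) * centredSum ν Z b ^ (2 * r + 1)).trace]
        simp [M]
    _ = ∫ z, ((Z j (z.1 j) - Z j (z.2 j)) * centredSum ν Z z.1 ^ (2 * r + 1)).trace ∂P := by
        rw [← integral_sub
          (integrable_trace_mul (X := fun w => w.1 j - M j) (by fun_prop) _)
          (integrable_trace_mul (X := fun w => w.2 j - M j) (by fun_prop) _)]
        simp only [← trace_sub, ← sub_mul, sub_sub_sub_cancel_right]
        rfl
    _ ≤ ∫ z, (2 * r + 1) *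
        ((Z j (z.1 j) - Z j (z.2 j)) ^ 2 * centredSum ν Z z.1 ^ (2 * r)).trace ∂P := by
        refine integral_le_integral_of_add_comp_le (measurePreserving_coordSwap ν j)
          (integrable_trace_mul (X := fun w => w.1 j - w.2 j) (by fun_prop) _)
          ((integrable_trace_mul (X := fun w => (w.1 j - w.2 j) ^ 2) (by fun_prop) _).const_mul _)
          fun z => ?_
        have mean_value := trace_sub_mul_pow_sub_pow_le (isHermitian_centredSum ν hZ z.1)
          (isHermitian_centredSum ν hZ (coordSwap j z).1) r
        rw [centredSum_sub_centredSum_coordSwap, Matrix.mul_sub, trace_sub] at mean_value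
        have swap_fst : (coordSwap j z).1 j = z.2 j := by simp [coordSwap]
        have swap_snd : (coordSwap j z).2 j = z.1 j := by simp [coordSwap]
        rw [swap_fst, swap_snd, ← neg_sub (Z j (z.1 j)), neg_sq, neg_mul, trace_neg]
        linarith
    _ = _ := integral_const_mul _ _

lemma integral_trace_centredSum_pow_le_integral_sq_sub (hZ : ∀ j ω, (Z j ω).IsHermitian)
    (hZm : ∀ j, StronglyMeasurable (Z j)) (hZC : ∀ j ω, ‖Z j ω‖ ≤ C) (r : ℕ) :
    ∫ b, (centredSum ν Z b ^ (2 * (r + 1))).trace ∂Measure.pi ν ≤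
      (2 * r + 1) * ∫ z : (J → Ω) × (J → Ω),
        ∑ j, ((Z j (z.1 j) - Z j (z.2 j)) ^ 2 * centredSum ν Z z.1 ^ (2 * r)).trace
          ∂(Measure.pi ν).prod (Measure.pi ν) := by
  have integrable_coord (j : J) : Integrable (fun b : J → Ω =>
      ((Z j (b j) - ∫ ω, Z j ω ∂ν j) * centredSum ν Z b ^ (2 * r + 1)).trace) (Measure.pi ν) :=
    .of_comp_fst (ν := Measure.pi ν) (integrable_trace_mul_centredSum_pow ν hZm hZC
      (X := fun w => w.1 j - ∫ ω, Z j ω ∂ν j) (by fun_prop) _) (NeZero.ne _)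
  simp only [show 2 * (r + 1) = 2 * r + 1 + 1 by ring, trace_centredSum_pow_succ]
  rw [integral_finsetSum _ fun j _ => integrable_coord j,
    integral_finsetSum _ fun j _ => integrable_trace_mul_centredSum_pow ν hZm hZC
      (X := fun w => (w.1 j - w.2 j) ^ 2) (by fun_prop) _, Finset.mul_sum]
  exact Finset.sum_le_sum fun j _ => integral_trace_coord_mul_pow_le ν hZ hZm hZC r j

lemma add_one_mul_integral_sum_trace_sq_sub_mul_pow_le (hZ : ∀ j ω, (Z j ω).IsHermitian)
    (hZm : ∀ j, StronglyMeasurable (Z j)) (hZC : ∀ j ω, ‖Z j ω‖ ≤ C) {v : (J → Ω) → ℝ}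
    (hv0 : ∀ b, 0 ≤ v b) (hv : ∀ b, ∑ j, Z j (b j) ^ 2 ≤ v b • 1) (r : ℕ)
    (hvr : Integrable (fun b => v b ^ (r + 1)) (Measure.pi ν)) :
    (r + 1) * ((2 * r + 1) * ∫ z : (J → Ω) × (J → Ω),
        ∑ j, ((Z j (z.1 j) - Z j (z.2 j)) ^ 2 * centredSum ν Z z.1 ^ (2 * r)).trace
          ∂(Measure.pi ν).prod (Measure.pi ν)) ≤
      r * ∫ b, (centredSum ν Z b ^ (2 * (r + 1))).trace ∂Measure.pi ν +
        Fintype.card ι * (4 * (2 * r + 1)) ^ (r + 1) * ∫ b, v b ^ (r + 1) ∂Measure.pi ν := by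
  have integrable_diff := integrable_finsetSum Finset.univ fun j _ =>
    integrable_trace_mul_centredSum_pow ν hZm hZC (X := fun w => (w.1 j - w.2 j) ^ 2)
      (by fun_prop) (2 * r)
  have integrable_trace := integrable_trace_mul_centredSum_pow ν hZm hZC
    (X := fun _ => 1) (by fun_prop) (2 * (r + 1))
  simp only [Matrix.one_mul] at integrable_trace
  have integrable_proxy : Integrable
      (fun z : (J → Ω) × (J → Ω) => v z.1 ^ (r + 1) + v z.2 ^ (r + 1))
      ((Measure.pi ν).prod (Measure.pi ν)) :=
    (hvr.comp_fst _).add (hvr.comp_snd _)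
  have integral_trace := integral_fun_fst (μ := Measure.pi ν) (ν := Measure.pi ν)
    fun b => (centredSum ν Z b ^ (2 * (r + 1))).trace
  have integral_proxy : ∫ z : (J → Ω) × (J → Ω), v z.1 ^ (r + 1) + v z.2 ^ (r + 1)
      ∂(Measure.pi ν).prod (Measure.pi ν) = 2 * ∫ b, v b ^ (r + 1) ∂Measure.pi ν := by
    rw [integral_add (hvr.comp_fst _) (hvr.comp_snd _), integral_fun_fst fun b => v b ^ (r + 1),
      integral_fun_snd fun b => v b ^ (r + 1), probReal_univ, one_smul, two_mul]
  rw [probReal_univ, one_smul] at integral_trace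
  have integrated := integral_mono ((integrable_diff.const_mul _).const_mul _)
    ((integrable_trace.const_mul _).fun_add (integrable_proxy.const_mul _))
    (add_one_mul_sum_trace_sq_sub_mul_pow_le ν hZ hv0 hv r)
  rw [integral_const_mul, integral_const_mul, integral_add (integrable_trace.const_mul _)
    (integrable_proxy.const_mul _), integral_const_mul, integral_const_mul, integral_trace,
    integral_proxy] at integrated
  refine integrated.trans_eq ?_
  ring

lemma integral_trace_centredSum_pow_le (hZ : ∀ j ω, (Z j ω).IsHermitian)
    (hZm : ∀ j, StronglyMeasurable (Z j)) (hZC : ∀ j ω, ‖Z j ω‖ ≤ C) {v : (J → Ω) → ℝ}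
    (hv0 : ∀ b, 0 ≤ v b) (hv : ∀ b, ∑ j, Z j (b j) ^ 2 ≤ v b • 1) (r : ℕ)
    (hvr : Integrable (fun b => v b ^ (r + 1)) (Measure.pi ν)) :
    ∫ b, (centredSum ν Z b ^ (2 * (r + 1))).trace ∂Measure.pi ν ≤
      Fintype.card ι * (4 * (2 * r + 1)) ^ (r + 1) * ∫ b, v b ^ (r + 1) ∂Measure.pi ν := by
  have exchanged := mul_le_mul_of_nonneg_left
    (integral_trace_centredSum_pow_le_integral_sq_sub ν hZ hZm hZC r) (Nat.cast_add_one_pos r).le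
  have young := add_one_mul_integral_sum_trace_sq_sub_mul_pow_le ν hZ hZm hZC hv0 hv r hvr
  linarith

end Exchange

section RandomRows

variable {ι J : Type*}

/-- The `0`-`1` value of an entry of the adjacency matrix. -/
def edgeVal (e : Bool) : ℝ := if e then 1 else 0

lemma edgeVal_nonneg (e : Bool) : 0 ≤ edgeVal e := by cases e <;> simp [edgeVal]

lemma edgeVal_mul_self (e : Bool) : edgeVal e * edgeVal e = edgeVal e := by
  cases e <;> simp [edgeVal]

/-- The contribution of a row `β` of the adjacency matrix to the co-occurrence matrix. -/
def rowGram [DecidableEq ι] (β : ι → Bool) : Matrix ι ι ℝ :=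
  .of fun i k => if i = k then 0 else edgeVal (β i) * edgeVal (β k)

lemma isHermitian_rowGram [DecidableEq ι] (β : ι → Bool) : (rowGram β).IsHermitian := by
  ext i k
  simp only [rowGram, conjTranspose_apply, of_apply, star_trivial, eq_comm (a := k), mul_comm]

lemma rowGram_nonneg [DecidableEq ι] (β : ι → Bool) (i k : ι) : 0 ≤ rowGram β i k := by
  rw [rowGram, of_apply]
  split_ifs
  exacts [le_rfl, mul_nonneg (edgeVal_nonneg _) (edgeVal_nonneg _)]

lemma rowGram_le [DecidableEq ι] (β : ι → Bool) (i k : ι) :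
    rowGram β i k ≤ edgeVal (β i) * edgeVal (β k) := by
  rw [rowGram, of_apply]
  split_ifs
  exacts [mul_nonneg (edgeVal_nonneg _) (edgeVal_nonneg _), le_rfl]

/-- The number of ones in a row of the adjacency matrix. -/
def rowDegree [Fintype ι] (β : ι → Bool) : ℝ := ∑ i, edgeVal (β i)

/-- The number of ones in a column of the adjacency matrix. -/
def colDegree [Fintype J] (b : J → ι → Bool) (i : ι) : ℝ := ∑ j, edgeVal (b j i)

lemma rowDegree_nonneg [Fintype ι] (β : ι → Bool) : 0 ≤ rowDegree β :=
  Finset.sum_nonneg fun _ _ => edgeVal_nonneg _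

lemma colDegree_nonneg [Fintype J] (b : J → ι → Bool) (i : ι) : 0 ≤ colDegree b i :=
  Finset.sum_nonneg fun _ _ => edgeVal_nonneg _

variable [Fintype ι]

lemma sq_rowGram_mulVec_le [DecidableEq ι] (β : ι → Bool) (x : ι → ℝ) (i : ι) :
    (rowGram β *ᵥ x) i ^ 2 ≤
      edgeVal (β i) * (rowDegree β * ∑ k, edgeVal (β k) * x k ^ 2) := by
  have sum_rowGram_le : ∑ k, rowGram β i k ≤ edgeVal (β i) * rowDegree β := by
    rw [rowDegree, Finset.mul_sum]
    exact Finset.sum_le_sum fun k _ => rowGram_le β i k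
  have weighted_le : ∑ k, rowGram β i k * x k ^ 2 ≤
      edgeVal (β i) * ∑ k, edgeVal (β k) * x k ^ 2 := by
    rw [Finset.mul_sum]
    exact Finset.sum_le_sum fun k _ => by
      rw [← mul_assoc]
      exact mul_le_mul_of_nonneg_right (rowGram_le β i k) (sq_nonneg _)
  calc (rowGram β *ᵥ x) i ^ 2
      ≤ (∑ k, rowGram β i k) * ∑ k, rowGram β i k * x k ^ 2 :=
        Finset.sum_sq_le_sum_mul_sum_of_sq_le_mul _ (fun k _ => rowGram_nonneg β i k)
          (fun k _ => mul_nonneg (rowGram_nonneg β i k) (sq_nonneg _))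
          fun k _ => (by ring : _ = _).le
    _ ≤ (edgeVal (β i) * rowDegree β) * (edgeVal (β i) * ∑ k, edgeVal (β k) * x k ^ 2) := by
        gcongr
        · exact Finset.sum_nonneg fun k _ => mul_nonneg (rowGram_nonneg β i k) (sq_nonneg _)
        · exact mul_nonneg (edgeVal_nonneg _) (rowDegree_nonneg β)
    _ = edgeVal (β i) * (rowDegree β * ∑ k, edgeVal (β k) * x k ^ 2) := by
        linear_combination (rowDegree β * ∑ k, edgeVal (β k) * x k ^ 2) * edgeVal_mul_self (β i)

lemma sq_rowGram_le_smul_diagonal [DecidableEq ι] (β : ι → Bool) :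
    rowGram β ^ 2 ≤ rowDegree β ^ 2 • diagonal fun i => edgeVal (β i) := by
  have hermitian :
      (rowDegree β ^ 2 • diagonal (fun i => edgeVal (β i)) - rowGram β ^ 2).IsHermitian :=
    ((isHermitian_diagonal _).smul (.all _)).sub ((isHermitian_rowGram β).pow 2)
  refine Matrix.le_iff.2 (.of_dotProduct_mulVec_nonneg hermitian fun x => ?_)
  have quadratic_form : x ⬝ᵥ rowGram β ^ 2 *ᵥ x = ∑ i, (rowGram β *ᵥ x) i ^ 2 := by
    conv_lhs => rw [sq, ← mulVec_mulVec, dotProduct_mulVec, ← mulVec_transpose,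
      ← conjTranspose_eq_transpose_of_trivial, (isHermitian_rowGram β).eq]
    simp only [dotProduct, sq]
  rw [star_trivial, sub_mulVec, dotProduct_sub, quadratic_form, sub_nonneg]
  calc ∑ i, (rowGram β *ᵥ x) i ^ 2
      ≤ ∑ i, edgeVal (β i) * (rowDegree β * ∑ k, edgeVal (β k) * x k ^ 2) :=
        Finset.sum_le_sum fun i _ => sq_rowGram_mulVec_le β x i
    _ = rowDegree β ^ 2 * ∑ k, edgeVal (β k) * x k ^ 2 := by
        rw [← Finset.sum_mul, ← rowDegree]; ring
    _ = x ⬝ᵥ (rowDegree β ^ 2 • diagonal fun i => edgeVal (β i)) *ᵥ x := by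
        rw [smul_mulVec, dotProduct_smul, smul_eq_mul]
        simp only [dotProduct, mulVec_diagonal]
        congr 1
        exact Finset.sum_congr rfl fun k _ => by ring

variable [Fintype J]

/-- The squared largest row degree times the largest column degree. It bounds the sum of the
squares of the matrices `rowGram (b j)`, see `sum_sq_rowGram_le_smul_one`. -/
noncomputable def degreeProxy (b : J → ι → Bool) : ℝ :=
  (⨆ j, rowDegree (b j)) ^ 2 * ⨆ i, colDegree b i

lemma degreeProxy_nonneg (b : J → ι → Bool) : 0 ≤ degreeProxy b :=
  mul_nonneg (sq_nonneg _) (Real.iSup_nonneg fun i => colDegree_nonneg b i)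

lemma sum_sq_rowGram_le_smul_one [DecidableEq ι] (b : J → ι → Bool) :
    ∑ j, rowGram (b j) ^ 2 ≤ degreeProxy b • (1 : Matrix ι ι ℝ) := by
  calc ∑ j, rowGram (b j) ^ 2
      ≤ ∑ j, rowDegree (b j) ^ 2 • diagonal (fun i => edgeVal (b j i)) :=
        Finset.sum_le_sum fun j _ => sq_rowGram_le_smul_diagonal (b j)
    _ = diagonal fun i => ∑ j, rowDegree (b j) ^ 2 * edgeVal (b j i) := by
        ext i k
        rcases eq_or_ne i k with rfl | h <;> simp [Matrix.sum_apply, *]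
    _ ≤ diagonal fun _ => degreeProxy b := by
        rw [Matrix.le_iff, diagonal_sub]
        refine .diagonal fun i => sub_nonneg.2 ?_
        calc ∑ j, rowDegree (b j) ^ 2 * edgeVal (b j i)
            ≤ ∑ j, (⨆ j, rowDegree (b j)) ^ 2 * edgeVal (b j i) := by
              gcongr with j
              · exact edgeVal_nonneg _
              · exact rowDegree_nonneg _
              · exact le_ciSup (Set.finite_range fun j => rowDegree (b j)).bddAbove j
          _ = (⨆ j, rowDegree (b j)) ^ 2 * colDegree b i := (Finset.mul_sum ..).symm
          _ ≤ degreeProxy b := by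
              unfold degreeProxy
              gcongr
              exact le_ciSup (Set.finite_range (colDegree b)).bddAbove i
    _ = degreeProxy b • (1 : Matrix ι ι ℝ) := by rw [smul_one_eq_diagonal]

lemma iSup_pow_le_sum {α : Type*} [Fintype α] {f : α → ℝ} (hf : ∀ a, 0 ≤ f a) {q : ℕ}
    (hq : q ≠ 0) : (⨆ a, f a) ^ q ≤ ∑ a, f a ^ q := by
  rcases isEmpty_or_nonempty α with _ | _
  · simp [hq]
  · obtain ⟨a, ha⟩ := exists_eq_ciSup_of_finite (f := f)
    rw [← ha]
    exact Finset.single_le_sum (f := fun a => f a ^ q) (fun a _ => pow_nonneg (hf a) q)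
      (Finset.mem_univ a)

lemma iSup_pow_le_pow_mul_sum_exp {α : Type*} [Fintype α] {f : α → ℝ} (hf : ∀ a, 0 ≤ f a) {q : ℕ}
    (hq : q ≠ 0) : (⨆ a, f a) ^ q ≤ q ^ q * ∑ a, Real.exp (f a) := by
  rw [Finset.mul_sum]
  refine (iSup_pow_le_sum hf hq).trans (Finset.sum_le_sum fun a _ => ?_)
  calc f a ^ q ≤ q.factorial * Real.exp (f a) :=
        (div_le_iff₀' (by positivity)).1 (Real.pow_div_factorial_le_exp (f a) (hf a) q)
    _ ≤ q ^ q * Real.exp (f a) := by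
        gcongr
        exact_mod_cast q.factorial_le_pow

lemma degreeProxy_pow_le (b : J → ι → Bool) {s : ℝ} (hs : 0 < s) {p : ℕ} (hp : p ≠ 0) :
    degreeProxy b ^ p ≤ (3 * p) ^ (3 * p) / s ^ p *
      (∑ j, Real.exp (rowDegree (b j)) + ∑ i, Real.exp (s * colDegree b i)) := by
  have max_row_nonneg : 0 ≤ ⨆ j, rowDegree (b j) := Real.iSup_nonneg fun j => rowDegree_nonneg _
  have max_col_nonneg : 0 ≤ s * ⨆ i, colDegree b i :=
    mul_nonneg hs.le (Real.iSup_nonneg fun i => colDegree_nonneg b i)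
  have row_pow_le := iSup_pow_le_pow_mul_sum_exp (fun j => rowDegree_nonneg (b j))
    (Nat.mul_ne_zero three_ne_zero hp)
  have col_pow_le := iSup_pow_le_pow_mul_sum_exp
    (fun i => mul_nonneg hs.le (colDegree_nonneg b i)) (Nat.mul_ne_zero three_ne_zero hp)
  rw [← Real.mul_iSup_of_nonneg hs.le] at col_pow_le
  push_cast at row_pow_le col_pow_le
  rw [div_mul_eq_mul_div, le_div_iff₀ (by positivity)]
  calc degreeProxy b ^ p * s ^ p
      = (⨆ j, rowDegree (b j)) ^ (2 * p) * (s * ⨆ i, colDegree b i) ^ p := by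
        rw [degreeProxy]; ring
    _ ≤ (⨆ j, rowDegree (b j)) ^ (3 * p) + (s * ⨆ i, colDegree b i) ^ (3 * p) := by
        simpa only [← Nat.add_one_mul] using
          pow_mul_pow_le_add max_row_nonneg max_col_nonneg (2 * p) p
    _ ≤ (3 * p) ^ (3 * p) *
        (∑ j, Real.exp (rowDegree (b j)) + ∑ i, Real.exp (s * colDegree b i)) := by
        rw [mul_add]
        exact add_le_add row_pow_le col_pow_le

/-- A law of random rows is `θ`-sparse if the exponential moments of its entries, with weights in
`[0, 1]`, are at most those that independent entries of probability at most `θ` would have. -/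
def IsSparse (θ : ℝ) (ν : Measure (ι → Bool)) : Prop :=
  ∀ s : ι → ℝ, (∀ i, s i ∈ Set.Icc 0 1) →
    ∫ β, Real.exp (∑ i, s i * edgeVal (β i)) ∂ν ≤ Real.exp (2 * θ * ∑ i, s i)

lemma IsSparse.integral_exp_rowDegree_le {θ : ℝ} {ν : Measure (ι → Bool)} (hν : IsSparse θ ν) :
    ∫ β, Real.exp (rowDegree β) ∂ν ≤ Real.exp (2 * θ * Fintype.card ι) := by
  simpa [rowDegree] using hν 1 fun _ => by simp

lemma IsSparse.integral_exp_mul_edgeVal_le {θ : ℝ} {ν : Measure (ι → Bool)} (hν : IsSparse θ ν)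
    {s : ℝ} (hs : s ∈ Set.Icc 0 1) (i : ι) :
    ∫ β, Real.exp (s * edgeVal (β i)) ∂ν ≤ Real.exp (2 * θ * s) := by
  classical
  simpa [Pi.single_apply] using hν (Pi.single i s) fun k => by
    rw [Pi.single_apply]
    split_ifs
    exacts [hs, by simp]

lemma integral_exp_mul_colDegree_le {θ : ℝ} {ν : J → Measure (ι → Bool)}
    [∀ j, IsProbabilityMeasure (ν j)] (hν : ∀ j, IsSparse θ (ν j)) {s : ℝ}
    (hs : s ∈ Set.Icc 0 1) (i : ι) :
    ∫ b, Real.exp (s * colDegree b i) ∂Measure.pi ν ≤ Real.exp (2 * θ * s * Fintype.card J) := by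
  calc ∫ b, Real.exp (s * colDegree b i) ∂Measure.pi ν
      = ∏ j, ∫ β, Real.exp (s * edgeVal (β i)) ∂ν j := by
        simp only [colDegree, Finset.mul_sum, Real.exp_sum]
        exact integral_fintype_prod_eq_prod fun _ (β : ι → Bool) => Real.exp (s * edgeVal (β i))
    _ ≤ ∏ _j : J, Real.exp (2 * θ * s) :=
        Finset.prod_le_prod (fun j _ => integral_nonneg fun β => (Real.exp_pos _).le)
          fun j _ => (hν j).integral_exp_mul_edgeVal_le hs i
    _ = Real.exp (2 * θ * s * Fintype.card J) := by
        rw [Finset.prod_const, ← Real.exp_nat_mul, Finset.card_univ, mul_comm]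

lemma integral_degreeProxy_pow_le {θ : ℝ} {ν : J → Measure (ι → Bool)}
    [∀ j, IsProbabilityMeasure (ν j)] (hν : ∀ j, IsSparse θ (ν j))
    (hθ : 1 ≤ θ * Fintype.card J) {p : ℕ} (hp : p ≠ 0) :
    ∫ b, degreeProxy b ^ p ∂Measure.pi ν ≤ (3 * p) ^ (3 * p) * (θ * Fintype.card J) ^ p *
      (Fintype.card J * Real.exp (2 * θ * Fintype.card ι) + Fintype.card ι * Real.exp 2) := by
  have scale_pos : 0 < θ * Fintype.card J := one_pos.trans_le hθ
  -- With this weight the exponent of the column bound is the constant `2`.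
  set s := (θ * Fintype.card J)⁻¹
  have hs : s ∈ Set.Icc 0 1 := ⟨by positivity, inv_le_one_of_one_le₀ hθ⟩
  have col_bound (i : ι) : ∫ b, Real.exp (s * colDegree b i) ∂Measure.pi ν ≤ Real.exp 2 := by
    have := integral_exp_mul_colDegree_le hν hs i
    rwa [show 2 * θ * s * Fintype.card J = 2 by
      rw [mul_right_comm _ s, mul_assoc 2, mul_assoc, mul_inv_cancel₀ scale_pos.ne',
        mul_one]] at this
  have row_bound (j : J) : ∫ b, Real.exp (rowDegree (b j)) ∂Measure.pi ν ≤
      Real.exp (2 * θ * Fintype.card ι) :=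
    (integral_comp_eval (μ := ν) (.of_discrete)).trans_le (hν j).integral_exp_rowDegree_le
  calc ∫ b, degreeProxy b ^ p ∂Measure.pi ν
      ≤ ∫ b, (3 * p) ^ (3 * p) / s ^ p *
        (∑ j, Real.exp (rowDegree (b j)) + ∑ i, Real.exp (s * colDegree b i)) ∂Measure.pi ν :=
        integral_mono .of_finite .of_finite fun b => degreeProxy_pow_le b (by positivity) hp
    _ = (3 * p) ^ (3 * p) * (θ * Fintype.card J) ^ p *
        (∑ j, ∫ b, Real.exp (rowDegree (b j)) ∂Measure.pi ν +
          ∑ i, ∫ b, Real.exp (s * colDegree b i) ∂Measure.pi ν) := by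
        rw [integral_const_mul, integral_add .of_finite .of_finite,
          integral_finsetSum _ fun _ _ => .of_finite, integral_finsetSum _ fun _ _ => .of_finite,
          inv_pow, div_inv_eq_mul]
    _ ≤ _ := by
        have row_sum := Finset.sum_le_card_nsmul Finset.univ _ _ fun j _ => row_bound j
        have col_sum := Finset.sum_le_card_nsmul Finset.univ _ _ fun i _ => col_bound i
        rw [nsmul_eq_mul, Finset.card_univ] at row_sum col_sum
        gcongr

end RandomRows

section SparseRows

variable {ι J : Type*} [Fintype ι] [DecidableEq ι] [Fintype J]

lemma integral_trace_centredSum_rowGram_pow_le {θ : ℝ} {ν : J → Measure (ι → Bool)}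
    [∀ j, IsProbabilityMeasure (ν j)] (hν : ∀ j, IsSparse θ (ν j))
    (hθ : 1 ≤ θ * Fintype.card J) {p : ℕ} (hp : p ≠ 0) :
    ∫ b, (centredSum ν (fun _ => rowGram) b ^ (2 * p)).trace ∂Measure.pi ν ≤
      Fintype.card ι * (Fintype.card J * Real.exp (2 * θ * Fintype.card ι) +
        Fintype.card ι * Real.exp 2) * (216 * p ^ 4 * (θ * Fintype.card J)) ^ p := by
  obtain ⟨r, rfl⟩ := Nat.exists_eq_add_one_of_ne_zero hp
  obtain ⟨C, norm_le⟩ := (Set.finite_range fun β : ι → Bool => ‖rowGram β‖).bddAbove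
  have moment := integral_trace_centredSum_pow_le ν (Z := fun _ => rowGram)
    (fun _ => isHermitian_rowGram) (fun _ => .of_discrete) (fun _ β => norm_le ⟨β, rfl⟩)
    degreeProxy_nonneg sum_sq_rowGram_le_smul_one r .of_finite
  have constant_le : (4 * (2 * r + 1) : ℝ) ≤ 8 * (r + 1) := by linarith
  calc _ ≤ Fintype.card ι * (4 * (2 * r + 1)) ^ (r + 1) *
        ∫ b, degreeProxy b ^ (r + 1) ∂Measure.pi ν := moment
    _ ≤ Fintype.card ι * (8 * (r + 1)) ^ (r + 1) *
        ((3 * (r + 1 : ℕ)) ^ (3 * (r + 1)) * (θ * Fintype.card J) ^ (r + 1) *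
          (Fintype.card J * Real.exp (2 * θ * Fintype.card ι) + Fintype.card ι * Real.exp 2)) := by
        gcongr
        · exact integral_nonneg fun b => pow_nonneg (degreeProxy_nonneg b) _
        · exact integral_degreeProxy_pow_le hν hθ hp
    _ = _ := by
        have power_eq : (216 * (r + 1 : ℝ) ^ 4 * (θ * Fintype.card J)) ^ (r + 1) =
            (8 * (r + 1)) ^ (r + 1) * ((3 * (r + 1)) ^ 3) ^ (r + 1) *
              (θ * Fintype.card J) ^ (r + 1) := by
          rw [← mul_pow, ← mul_pow]; ring
        push_cast
        rw [power_eq, pow_mul _ 3]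
        ring

lemma measureReal_lt_norm_centredSum_rowGram_le {θ : ℝ} {ν : J → Measure (ι → Bool)}
    [∀ j, IsProbabilityMeasure (ν j)] (hν : ∀ j, IsSparse θ (ν j))
    (hθ : 1 ≤ θ * Fintype.card J) {p : ℕ} (hp : p ≠ 0) {t : ℝ} (ht : 0 < t) :
    (Measure.pi ν).real {b | t < ‖centredSum ν (fun _ => rowGram) b‖} ≤
      Fintype.card ι * (Fintype.card J * Real.exp (2 * θ * Fintype.card ι) +
        Fintype.card ι * Real.exp 2) * (216 * p ^ 4 * (θ * Fintype.card J) / t ^ 2) ^ p := by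
  have hermitian := isHermitian_centredSum ν (fun _ => isHermitian_rowGram (ι := ι))
  have subset : {b | t < ‖centredSum ν (fun _ => rowGram) b‖} ⊆
      {b | t ^ (2 * p) ≤ (centredSum ν (fun _ => rowGram) b ^ (2 * p)).trace} := fun b hb => by
    by_contra h
    exact not_lt.2 (l2_opNorm_le_of_trace_pow_le (hermitian b) hp ht.le (not_le.1 h).le) hb
  have markov := mul_meas_ge_le_integral_of_nonneg (μ := Measure.pi ν)
    (.of_forall fun b => trace_pow_two_mul_nonneg (hermitian b) p) .of_finite (t ^ (2 * p))
  have bound := markov.trans (integral_trace_centredSum_rowGram_pow_le hν hθ hp)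
  rw [div_pow, ← pow_mul, ← mul_div_assoc, le_div_iff₀' (by positivity)]
  exact (mul_le_mul_of_nonneg_left (measureReal_mono subset) (by positivity)).trans bound

end SparseRows

section MixedRows

lemma measurable_measure_pi {α J : Type*} [MeasurableSpace α] [Fintype J] {X : J → Type*}
    [∀ j, MeasurableSpace (X j)] {μ : α → ∀ j, Measure (X j)}
    [∀ a j, IsProbabilityMeasure (μ a j)] (hμ : ∀ j, Measurable fun a => μ a j) :
    Measurable fun a => Measure.pi (μ a) := by
  refine .measure_of_isPiSystem_of_isProbabilityMeasure generateFrom_pi.symm isPiSystem_pi ?_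
  rintro _ ⟨s, hs, rfl⟩
  simp only [Measure.pi_pi]
  exact Finset.measurable_prod _ fun j _ => (Measure.measurable_coe (hs j trivial)).comp (hμ j)

lemma pi_bind_measure_pi {J Y Ω : Type*} [Fintype J] [MeasurableSpace Y] [MeasurableSpace Ω]
    (D : J → Measure Y) [∀ j, IsProbabilityMeasure (D j)] {κ : Y → Measure Ω}
    [∀ y, IsProbabilityMeasure (κ y)] (hκ : Measurable κ) :
    (Measure.pi D).bind (fun y => Measure.pi fun j => κ (y j)) =
      Measure.pi fun j => (D j).bind κ := by
  have (j : J) : IsProbabilityMeasure ((D j).bind κ) :=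
    isProbabilityMeasure_bind hκ.aemeasurable (.of_forall inferInstance)
  refine (Measure.pi_eq fun s hs => ?_).symm
  have measurable_pi := measurable_measure_pi (μ := fun (y : J → Y) j => κ (y j))
    fun j => hκ.comp (measurable_pi_apply j)
  rw [Measure.bind_apply (.univ_pi hs) measurable_pi.aemeasurable]
  simp only [Measure.pi_pi, Measure.bind_apply (hs _) hκ.aemeasurable]
  have measurable_coe (j : J) : Measurable fun y => κ y (s j) :=
    (Measure.measurable_coe (hs j)).comp hκ
  rw [lintegral_prod_eq_prod_lintegral_of_indepFun _ _
    (iIndepFun_pi fun j => (measurable_coe j).aemeasurable)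
    fun j => (measurable_coe j).comp (measurable_pi_apply j)]
  exact Finset.prod_congr rfl fun j _ =>
    (measurePreserving_eval D j).lintegral_comp (measurable_coe j)

lemma integral_bind {Y Ω E : Type*} [MeasurableSpace Y] [MeasurableSpace Ω]
    [NormedAddCommGroup E] [NormedSpace ℝ E] {D : Measure Y} [SFinite D] {κ : Y → Measure Ω}
    [∀ y, IsProbabilityMeasure (κ y)] (hκ : Measurable κ) {f : Ω → E}
    (hf : Integrable f (D.bind κ)) : ∫ ω, f ω ∂D.bind κ = ∫ y, ∫ ω, f ω ∂κ y ∂D := by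
  let K : Kernel Y Ω := ⟨κ, hκ⟩
  have : IsMarkovKernel K := ⟨fun y => inferInstanceAs (IsProbabilityMeasure (κ y))⟩
  have bind_eq : D.bind κ = (K ∘ₖ Kernel.const Unit D) () :=
    Measure.comp_eq_comp_const_apply (κ := K) (μ := D)
  rw [bind_eq] at hf ⊢
  exact Kernel.integral_comp hf

lemma measurable_bernoulliMeasure : Measurable fun q : I => bernoulliMeasure true false q := by
  refine Measure.measurable_of_measurable_coe _ fun s _ => ?_
  have sum_singleton (q : I) : bernoulliMeasure true false q s =
      ∑ e ∈ s.toFinite.toFinset, bernoulliMeasure true false q {e} := by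
    rw [sum_measure_singleton, Set.Finite.coe_toFinset]
  simp only [sum_singleton]
  exact Finset.measurable_sum _ fun e _ => measurable_bernoulliMeasure_singleton e

variable {ι Y : Type*} [Fintype ι] [MeasurableSpace Y]

/-- The law of a random row whose entries are, given a latent position `y` with law `D`,
independent and equal to `true` with probability `p y i`. -/
noncomputable def mixedRowLaw (D : Measure Y) (p : Y → ι → I) : Measure (ι → Bool) :=
  D.bind fun y => Measure.pi fun i => bernoulliMeasure true false (p y i)

lemma measurable_pi_bernoulliMeasure {p : Y → ι → I} (hp : Measurable p) :
    Measurable fun y => Measure.pi fun i => bernoulliMeasure true false (p y i) :=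
  measurable_measure_pi fun i => measurable_bernoulliMeasure.comp (measurable_pi_iff.1 hp i)

lemma isProbabilityMeasure_mixedRowLaw (D : Measure Y) [IsProbabilityMeasure D] {p : Y → ι → I}
    (hp : Measurable p) : IsProbabilityMeasure (mixedRowLaw D p) :=
  isProbabilityMeasure_bind (measurable_pi_bernoulliMeasure hp).aemeasurable
    (.of_forall inferInstance)

lemma exp_le_one_add_two_mul {s : ℝ} (hs : s ∈ Set.Icc 0 1) : Real.exp s ≤ 1 + 2 * s := by
  have := (le_abs_self _).trans (Real.abs_exp_sub_one_le ((abs_of_nonneg hs.1).trans_le hs.2))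
  rw [abs_of_nonneg hs.1] at this
  linarith

lemma integral_exp_mul_edgeVal_bernoulliMeasure_le {q : I} {θ s : ℝ} (hq : q ≤ θ)
    (hs : s ∈ Set.Icc 0 1) :
    ∫ e, Real.exp (s * edgeVal e) ∂bernoulliMeasure true false q ≤ Real.exp (2 * θ * s) := by
  rw [integral_bernoulliMeasure]
  have exp_le := mul_le_mul_of_nonneg_left (exp_le_one_add_two_mul hs) q.2.1
  have mono := mul_le_mul_of_nonneg_right hq hs.1
  have := Real.add_one_le_exp (2 * θ * s)
  simp only [edgeVal, ↓reduceIte, mul_one, smul_eq_mul, Bool.false_eq_true, mul_zero,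
    Real.exp_zero, ge_iff_le]
  linarith

lemma isSparse_pi_bernoulliMeasure {p : ι → I} {θ : ℝ} (hθ : ∀ i, p i ≤ θ) :
    IsSparse θ (Measure.pi fun i => bernoulliMeasure true false (p i)) := fun s hs => by
  calc ∫ β, Real.exp (∑ i, s i * edgeVal (β i))
        ∂(Measure.pi fun i => bernoulliMeasure true false (p i))
      = ∏ i, ∫ e, Real.exp (s i * edgeVal e) ∂bernoulliMeasure true false (p i) := by
        simp only [Real.exp_sum]
        exact integral_fintype_prod_eq_prod fun i e => Real.exp (s i * edgeVal e)
    _ ≤ ∏ i, Real.exp (2 * θ * s i) :=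
        Finset.prod_le_prod (fun i _ => integral_nonneg fun e => (Real.exp_pos _).le)
          fun i _ => integral_exp_mul_edgeVal_bernoulliMeasure_le (hθ i) (hs i)
    _ = Real.exp (2 * θ * ∑ i, s i) := by rw [← Real.exp_sum, Finset.mul_sum]

lemma IsSparse.bind {D : Measure Y} [IsProbabilityMeasure D] {κ : Y → Measure (ι → Bool)}
    [∀ y, IsProbabilityMeasure (κ y)] (hκ : Measurable κ) {θ : ℝ} (h : ∀ y, IsSparse θ (κ y)) :
    IsSparse θ (D.bind κ) := fun s hs => by
  have : IsProbabilityMeasure (D.bind κ) :=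
    isProbabilityMeasure_bind hκ.aemeasurable (.of_forall inferInstance)
  rw [integral_bind hκ .of_finite]
  simpa only [integral_const, probReal_univ, one_smul] using integral_mono_of_nonneg (μ := D)
    (.of_forall fun y => integral_nonneg fun β => (Real.exp_pos _).le)
    (integrable_const (Real.exp (2 * θ * ∑ i, s i))) (.of_forall fun y => h y s hs)

lemma isSparse_mixedRowLaw (D : Measure Y) [IsProbabilityMeasure D] {p : Y → ι → I}
    (hp : Measurable p) {θ : ℝ} (hθ : ∀ y i, p y i ≤ θ) : IsSparse θ (mixedRowLaw D p) :=
  .bind (measurable_pi_bernoulliMeasure hp) fun y => isSparse_pi_bernoulliMeasure (hθ y)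

lemma integral_edgeVal_mul_edgeVal {p : ι → I} {i k : ι} (hik : i ≠ k) :
    ∫ β, edgeVal (β i) * edgeVal (β k) ∂(Measure.pi fun i => bernoulliMeasure true false (p i)) =
      p i * p k := by
  have integral_edgeVal (i : ι) :
      ∫ β, edgeVal (β i) ∂(Measure.pi fun i => bernoulliMeasure true false (p i)) = p i := by
    rw [integral_comp_eval (.of_discrete), integral_bernoulliMeasure]
    simp [edgeVal]
  have indep := iIndepFun_pi (μ := fun i => bernoulliMeasure true false (p i))
    (X := fun _ => edgeVal) fun _ => Measurable.of_discrete.aemeasurable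
  rw [(indep.indepFun hik).integral_fun_mul_eq_mul_integral .of_discrete .of_discrete,
    integral_edgeVal, integral_edgeVal]

lemma integral_rowGram_mixedRowLaw_apply [DecidableEq ι] (D : Measure Y) [IsProbabilityMeasure D]
    {p : Y → ι → I} (hp : Measurable p) (i k : ι) :
    (∫ β, rowGram β ∂mixedRowLaw D p) i k =
      if i = k then 0 else ∫ y, (p y i : ℝ) * p y k ∂D := by
  have := isProbabilityMeasure_mixedRowLaw D hp
  have integrable (f : (ι → Bool) → ℝ) : Integrable f (mixedRowLaw D p) := .of_finite
  have entry := (entryLinearMap ℝ ℝ i k).toContinuousLinearMap.integral_comp_comm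
    (μ := mixedRowLaw D p) (φ := rowGram) .of_finite
  refine entry.symm.trans ?_
  split_ifs with hik
  · simp [rowGram, hik]
  · simp only [LinearMap.coe_toContinuousLinearMap', entryLinearMap_apply, rowGram, of_apply, hik,
      if_false]
    rw [mixedRowLaw, integral_bind (measurable_pi_bernoulliMeasure hp) (integrable _)]
    simp only [integral_edgeVal_mul_edgeVal hik]

end MixedRows

section Deviation

variable {c₀ c₁ Δ : ℝ} {n m : ℕ}

lemma coMatrix_eq_sum_rowGram (b : Fin m → Fin n → Bool) : coMatrix b = ∑ j, rowGram (b j) := by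
  ext i k
  rw [Matrix.sum_apply]
  by_cases h : i = k <;> simp [coMatrix, rowGram, h, adjMatrix, edgeVal, Matrix.mul_apply]

lemma measurable_sqKernel (D : Measure I) [SFinite D] :
    Measurable fun p : I × I => sqKernel c₀ c₁ Δ D p.1 p.2 := by
  have measurable_integrand : Measurable fun q : (I × I) × I =>
      kernel c₀ c₁ Δ q.1.1 q.2 * kernel c₀ c₁ Δ q.2 q.1.2 := by
    unfold kernel
    fun_prop
  exact measurable_integrand.stronglyMeasurable.integral_prod_right.measurable

lemma sqKernel_mem_Icc (h₀ : 0 < c₀) (h₁ : c₀ ≤ c₁) (D : Measure I) [IsProbabilityMeasure D]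
    (x x' : I) : sqKernel c₀ c₁ Δ D x x' ∈ Set.Icc 0 1 := by
  have kernel_mem (x y : I) := kernel_mem c₀ c₁ Δ h₀ h₁ x y
  have nonneg (z : I) : 0 ≤ kernel c₀ c₁ Δ x z * kernel c₀ c₁ Δ z x' :=
    mul_nonneg (kernel_mem x z).1.le (kernel_mem z x').1.le
  have le_one (z : I) : kernel c₀ c₁ Δ x z * kernel c₀ c₁ Δ z x' ≤ 1 :=
    mul_le_one₀ (kernel_mem x z).2 (kernel_mem z x').1.le (kernel_mem z x').2
  refine ⟨integral_nonneg nonneg, ?_⟩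
  rw [sqKernel]
  simpa only [integral_const, probReal_univ, one_smul] using
    integral_mono_of_nonneg (μ := D) (.of_forall nonneg) (integrable_const 1) (.of_forall le_one)

lemma measurable_specNorm {α : Type*} [MeasurableSpace α] {X : α → Matrix (Fin n) (Fin n) ℝ}
    (hX : ∀ i k, Measurable fun a => X a i k) : Measurable fun a => specNorm (X a) := by
  have continuous_specNorm : Continuous fun A : Fin n → Fin n → ℝ => specNorm (.of A) :=
    continuous_norm.comp (LinearMap.continuous_of_finiteDimensional
      ((toEuclideanCLM (n := Fin n) (𝕜 := ℝ)).toAlgEquiv.toLinearMap ∘ₗ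
        (ofLinearEquiv ℝ).toLinearMap))
  exact continuous_specNorm.measurable.comp
    (measurable_pi_lambda _ fun i => measurable_pi_lambda _ fun k => hX i k)

/-- The matrix `(n / m) A - (1 / n) M` whose spectral norm is to be bounded. -/
noncomputable def deviation (c₀ c₁ Δ : ℝ) (D : Measure I) (x : Fin n → I)
    (b : Fin m → Fin n → Bool) : Matrix (Fin n) (Fin n) ℝ :=
  ((n : ℝ) / m) • coMatrix b - (1 / (n : ℝ)) • gramMatrix c₀ c₁ Δ D x

lemma measurable_specNorm_deviation (D : Measure I) [SFinite D] :
    Measurable fun ω : ((Fin n → I) × (Fin m → I)) × (Fin m → Fin n → Bool) =>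
      specNorm (deviation c₀ c₁ Δ D ω.1.1 ω.2) := by
  refine measurable_from_prod_countable_left fun b => measurable_specNorm fun i k => ?_
  have measurable_gram : Measurable fun p : (Fin n → I) × (Fin m → I) =>
      sqKernel c₀ c₁ Δ D (p.1 i) (p.1 k) := by
    have measurable_pair : Measurable fun p : (Fin n → I) × (Fin m → I) => (p.1 i, p.1 k) := by
      fun_prop
    simpa only [Function.comp_def] using (measurable_sqKernel D).comp measurable_pair
  exact (measurable_gram.const_mul (1 / n : ℝ)).const_sub ((n / m : ℝ) * coMatrix b i k)

/-- The conditional law of the edges of a single follower given the positions `x` of the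
influencers, the position of the follower being averaged out. -/
noncomputable def followerLaw (c₀ c₁ Δ : ℝ) (D : Measure I) (x : Fin n → I) :
    Measure (Fin n → Bool) :=
  mixedRowLaw D fun y i => edgeProb c₀ c₁ Δ n y (x i)

lemma measurable_edgeProb_left (x : Fin n → I) :
    Measurable fun y i => edgeProb c₀ c₁ Δ n y (x i) := by
  refine measurable_pi_lambda _ fun i => ?_
  have measurable_pair : Measurable fun y : I => (y, x i) := by fun_prop
  simpa only [Function.comp_def] using (measurable_edgeProb c₀ c₁ Δ n).comp measurable_pair

instance (D : Measure I) [IsProbabilityMeasure D] (x : Fin n → I) :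
    IsProbabilityMeasure (followerLaw c₀ c₁ Δ D x) :=
  isProbabilityMeasure_mixedRowLaw D (measurable_edgeProb_left x)

lemma isSparse_followerLaw (h₀ : 0 < c₀) (h₁ : c₀ ≤ c₁) (D : Measure I) [IsProbabilityMeasure D]
    (x : Fin n → I) : IsSparse (1 / n) (followerLaw c₀ c₁ Δ D x) :=
  isSparse_mixedRowLaw D (measurable_edgeProb_left x) fun y i => by
    rw [coe_edgeProb c₀ c₁ Δ h₀ h₁]
    exact div_le_div_of_nonneg_right (kernel_mem c₀ c₁ Δ h₀ h₁ y (x i)).2 n.cast_nonneg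

lemma kernel_comm (x y : I) : kernel c₀ c₁ Δ x y = kernel c₀ c₁ Δ y x := by
  rw [kernel, kernel, abs_sub_comm]

lemma integral_rowGram_followerLaw (h₀ : 0 < c₀) (h₁ : c₀ ≤ c₁) (D : Measure I)
    [IsProbabilityMeasure D] (x : Fin n → I) :
    ∫ β, rowGram β ∂followerLaw c₀ c₁ Δ D x = (1 / (n : ℝ) ^ 2) •
      (gramMatrix c₀ c₁ Δ D x - diagonal fun i => sqKernel c₀ c₁ Δ D (x i) (x i)) := by
  ext i k
  refine (integral_rowGram_mixedRowLaw_apply D (measurable_edgeProb_left x) i k).trans ?_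
  rcases eq_or_ne i k with rfl | hik
  · simp [gramMatrix]
  · have integrand (y : I) : kernel c₀ c₁ Δ y (x i) / n * (kernel c₀ c₁ Δ y (x k) / n) =
        1 / (n : ℝ) ^ 2 * (kernel c₀ c₁ Δ (x i) y * kernel c₀ c₁ Δ y (x k)) := by
      rw [kernel_comm (x i)]; ring
    simp only [coe_edgeProb c₀ c₁ Δ h₀ h₁, integrand, integral_const_mul, hik, if_false]
    simp [gramMatrix, sqKernel, hik]

lemma specNorm_deviation_le (h₀ : 0 < c₀) (h₁ : c₀ ≤ c₁) (D : Measure I)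
    [IsProbabilityMeasure D] (hm : m ≠ 0) (x : Fin n → I) (b : Fin m → Fin n → Bool) :
    specNorm (deviation c₀ c₁ Δ D x b) ≤
      n / m * ‖centredSum (fun _ => followerLaw c₀ c₁ Δ D x) (fun _ => rowGram) b‖ + 1 / n := by
  set d : Fin n → ℝ := fun i => sqKernel c₀ c₁ Δ D (x i) (x i)
  have deviation_eq : deviation c₀ c₁ Δ D x b =
      ((n : ℝ) / m) • centredSum (fun _ => followerLaw c₀ c₁ Δ D x) (fun _ => rowGram) b -
        (1 / (n : ℝ)) • diagonal d := by
    rw [deviation, coMatrix_eq_sum_rowGram, centredSum, Finset.sum_sub_distrib, Finset.sum_const,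
      integral_rowGram_followerLaw h₀ h₁, Finset.card_univ, Fintype.card_fin,
      ← Nat.cast_smul_eq_nsmul ℝ, smul_sub, smul_smul, smul_smul, smul_sub,
      show (n : ℝ) / m * m * (1 / (n : ℝ) ^ 2) = 1 / n by field_simp]
    abel
  have norm_diagonal_le : ‖diagonal d‖ ≤ 1 := by
    rw [l2_opNorm_diagonal, pi_norm_le_iff_of_nonneg zero_le_one]
    intro i
    have mem := sqKernel_mem_Icc (Δ := Δ) h₀ h₁ D (x i) (x i)
    exact (Real.norm_of_nonneg mem.1).trans_le mem.2
  calc specNorm (deviation c₀ c₁ Δ D x b) = ‖deviation c₀ c₁ Δ D x b‖ := rfl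
    _ ≤ n / m * ‖centredSum (fun _ => followerLaw c₀ c₁ Δ D x) (fun _ => rowGram) b‖ +
        1 / n * ‖diagonal d‖ := by
      rw [deviation_eq]
      refine (norm_sub_le _ _).trans_eq ?_
      rw [norm_smul, norm_smul, Real.norm_of_nonneg (by positivity),
        Real.norm_of_nonneg (by positivity)]
    _ ≤ _ := by
      gcongr
      exact mul_le_of_le_one_right (by positivity) norm_diagonal_le

lemma bind_edgeMeasure (D : Measure I) [IsProbabilityMeasure D] (x : Fin n → I) :
    (Measure.pi fun _ => D).bind (fun y => edgeMeasure c₀ c₁ Δ n m (x, y)) =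
      Measure.pi fun _ => followerLaw c₀ c₁ Δ D x := by
  simp only [edgeMeasure, followerLaw, mixedRowLaw]
  exact pi_bind_measure_pi
    (κ := fun y => Measure.pi fun i => bernoulliMeasure true false (edgeProb c₀ c₁ Δ n y (x i)))
    (fun _ => D) (measurable_pi_bernoulliMeasure (measurable_edgeProb_left x))

lemma law_apply {D : Measure I} [IsProbabilityMeasure D]
    {s : (Fin n → I) → Set (Fin m → Fin n → Bool)}
    (hs : MeasurableSet {ω : ((Fin n → I) × (Fin m → I)) × (Fin m → Fin n → Bool) |
      ω.2 ∈ s ω.1.1}) :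
    law c₀ c₁ Δ D n m {ω | ω.2 ∈ s ω.1.1} =
      ∫⁻ x, Measure.pi (fun _ => followerLaw c₀ c₁ Δ D x) (s x) ∂Measure.pi fun _ => D := by
  have measurable_edges (x : Fin n → I) : Measurable fun y => edgeMeasure c₀ c₁ Δ n m (x, y) :=
    (measurable_edgeMeasure c₀ c₁ Δ n m).comp measurable_prodMk_left
  rw [law, Measure.compProd_apply hs, lintegral_prod _
    (Kernel.measurable_kernel_prodMk_left hs).aemeasurable]
  refine lintegral_congr fun x => ?_
  rw [← bind_edgeMeasure, Measure.bind_apply .of_discrete (measurable_edges x).aemeasurable]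
  rfl

lemma law_real_le {D : Measure I} [IsProbabilityMeasure D]
    {s : (Fin n → I) → Set (Fin m → Fin n → Bool)}
    (hs : MeasurableSet {ω : ((Fin n → I) × (Fin m → I)) × (Fin m → Fin n → Bool) |
      ω.2 ∈ s ω.1.1}) {δ : ℝ}
    (hδ : ∀ x, (Measure.pi fun _ => followerLaw c₀ c₁ Δ D x).real (s x) ≤ δ) :
    (law c₀ c₁ Δ D n m).real {ω | ω.2 ∈ s ω.1.1} ≤ δ := by
  have δ_nonneg : 0 ≤ δ := measureReal_nonneg.trans (hδ 0)
  rw [measureReal_def, law_apply hs]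
  refine ENNReal.toReal_le_of_le_ofReal δ_nonneg ?_
  calc _ ≤ ∫⁻ _, ENNReal.ofReal δ ∂Measure.pi fun _ : Fin n => D :=
        lintegral_mono fun x =>
          (ENNReal.le_ofReal_iff_toReal_le (measure_ne_top _ _) δ_nonneg).2 (hδ x)
    _ = ENNReal.ofReal δ := by rw [lintegral_const, measure_univ, mul_one]

lemma law_real_lt_specNorm_deviation_le (h₀ : 0 < c₀) (h₁ : c₀ ≤ c₁) (D : Measure I)
    [IsProbabilityMeasure D] (hn : n ≠ 0) (hnm : n ≤ m) {p : ℕ} (hp : p ≠ 0) {t : ℝ} (ht : 0 < t) :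
    (law c₀ c₁ Δ D n m).real {ω | t + 1 / n < specNorm (deviation c₀ c₁ Δ D ω.1.1 ω.2)} ≤
      Real.exp 2 * n * (n + m) * (216 * p ^ 4 * (n / m) / t ^ 2) ^ p := by
  have n_pos : (0 : ℝ) < n := by exact_mod_cast hn.bot_lt
  have m_pos : (0 : ℝ) < m := by exact_mod_cast hn.bot_lt.trans_le hnm
  have one_le_div : (1 : ℝ) ≤ 1 / n * m := by
    rw [one_div_mul_eq_div, one_le_div n_pos]
    exact_mod_cast hnm
  refine law_real_le (s := fun x => {b | t + 1 / n < specNorm (deviation c₀ c₁ Δ D x b)})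
    (measurableSet_lt measurable_const (measurable_specNorm_deviation D)) fun x => ?_
  have subset : {b | t + 1 / n < specNorm (deviation c₀ c₁ Δ D x b)} ⊆ {b | m / n * t <
      ‖centredSum (fun _ : Fin m => followerLaw c₀ c₁ Δ D x) (fun _ => rowGram) b‖} := by
    intro b hb
    have := lt_of_add_lt_add_right
      (lt_of_lt_of_le hb (specNorm_deviation_le h₀ h₁ D (by exact_mod_cast m_pos.ne') x b))
    rwa [Set.mem_ofPred_eq, div_mul_eq_mul_div, div_lt_iff₀' n_pos, ← lt_div_iff₀' m_pos,
      mul_div_right_comm]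
  have tail := measureReal_lt_norm_centredSum_rowGram_le
    (fun _ : Fin m => isSparse_followerLaw (Δ := Δ) h₀ h₁ D x) (by simpa using one_le_div) hp
    (t := m / n * t) (by positivity)
  refine (measureReal_mono subset).trans (tail.trans_eq ?_)
  rw [Fintype.card_fin, Fintype.card_fin, mul_assoc 2, one_div_mul_cancel n_pos.ne', mul_one]
  have base_eq : 216 * (p : ℝ) ^ 4 * (1 / n * m) / (m / n * t) ^ 2 =
      216 * p ^ 4 * (n / m) / t ^ 2 := by field_simp
  rw [base_eq]
  ring

end Deviation

section Asymptotics

open Asymptotics Filter Topology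

lemma tendsto_log_natCast_atTop : Tendsto (fun n : ℕ => Real.log n) atTop atTop :=
  Real.tendsto_log_atTop.comp tendsto_natCast_atTop_atTop

variable {c : ℝ} {m : ℕ → ℕ}

lemma eventually_le_of_isBigO (hc : 0 < c)
    (hm : (fun n : ℕ => (n : ℝ) * Real.log n ^ c) =O[atTop] fun n => (m n : ℝ)) :
    ∀ᶠ n in atTop, n ≤ m n := by
  have one_isLittleO : (fun _ : ℕ => (1 : ℝ)) =o[atTop] fun n : ℕ => Real.log n ^ c :=
    isLittleO_const_left.2 <| .inr <|
      tendsto_norm_atTop_atTop.comp ((tendsto_rpow_atTop hc).comp tendsto_log_natCast_atTop)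
  have isLittleO :=
    ((isBigO_refl (fun n : ℕ => (n : ℝ)) atTop).mul_isLittleO one_isLittleO).trans_isBigO hm
  filter_upwards [isLittleO.bound one_pos] with n bound
  simpa using bound

lemma isBigO_div_rpow
    (hm : (fun n : ℕ => (n : ℝ) * Real.log n ^ c) =O[atTop] fun n => (m n : ℝ)) :
    (fun n : ℕ => (n : ℝ) / m n) =O[atTop] fun n : ℕ => Real.log n ^ (-c) := by
  have log_pos := tendsto_log_natCast_atTop.eventually_gt_atTop 0
  have inv_isBigO := hm.inv_rev <| by
    filter_upwards [log_pos, eventually_gt_atTop 0] with n log_pos n_pos h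
    exact absurd h (by positivity)
  refine ((isBigO_refl (fun n : ℕ => (n : ℝ)) atTop).mul inv_isBigO).congr' .rfl ?_
  filter_upwards [log_pos, eventually_gt_atTop 0] with n log_pos n_pos
  rw [mul_inv, mul_inv_cancel_left₀ (by positivity), Real.rpow_neg log_pos.le]

lemma tendsto_ceil_log_pow_mul_sqrt_div (hc : 8 < c)
    (hm : (fun n : ℕ => (n : ℝ) * Real.log n ^ c) =O[atTop] fun n => (m n : ℝ)) :
    Tendsto (fun n : ℕ => (⌈Real.log n⌉₊ : ℝ) ^ 4 * √(n / m n)) atTop (𝓝 0) := by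
  have ceil_isBigO : (fun n : ℕ => (⌈Real.log n⌉₊ : ℝ)) =O[atTop] fun n : ℕ => Real.log n :=
    isEquivalent_nat_ceil.isBigO.comp_tendsto tendsto_log_natCast_atTop
  have log_pos := tendsto_log_natCast_atTop.eventually_gt_atTop 0
  have sqrt_isBigO : (fun n : ℕ => √((n : ℝ) / m n)) =O[atTop] fun n : ℕ => √(Real.log n ^ (-c)) :=
    (isBigO_div_rpow hm).sqrt <|
      log_pos.mono fun n log_pos => (Real.rpow_pos_of_pos log_pos _).le
  refine ((ceil_isBigO.pow 4).mul sqrt_isBigO).trans_tendsto ?_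
  refine ((tendsto_rpow_neg_atTop (show 0 < c / 2 - 4 by linarith)).comp
    tendsto_log_natCast_atTop).congr' ?_
  filter_upwards [log_pos] with n log_pos
  rw [Function.comp_apply, Real.sqrt_eq_rpow, ← Real.rpow_mul log_pos.le, ← Real.rpow_natCast,
    ← Real.rpow_add log_pos]
  congr 1
  push_cast
  ring

lemma eventually_pow_ceil_log_le {β : ℕ → ℝ} (hβ₀ : ∀ n, 0 ≤ β n) (hβ : Tendsto β atTop (𝓝 0))
    (K : ℝ) : ∀ᶠ n : ℕ in atTop, β n ^ ⌈Real.log n⌉₊ ≤ (n : ℝ) ^ (-K) := by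
  filter_upwards [hβ.eventually_le_const (Real.exp_pos (-|K|)), eventually_gt_atTop 0]
    with n hβn n_pos
  have log_le_ceil := Nat.le_ceil (Real.log n)
  calc β n ^ ⌈Real.log n⌉₊ ≤ Real.exp (-|K|) ^ ⌈Real.log n⌉₊ := pow_le_pow_left₀ (hβ₀ n) hβn _
    _ = Real.exp (-(|K| * ⌈Real.log n⌉₊)) := by rw [← Real.exp_nat_mul]; ring_nf
    _ ≤ Real.exp (-(K * Real.log n)) := by
        gcongr
        exact le_abs_self K
    _ = (n : ℝ) ^ (-K) := by
        rw [Real.rpow_def_of_pos (by positivity)]; ring_nf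

lemma exp_two_mul_lt_pow_seven {n m : ℕ} (hn : 16 < n) (hm : m ≤ n ^ 5) :
    Real.exp 2 * n * (n + m) < (n : ℝ) ^ 7 := by
  have exp_two_le : Real.exp 2 ≤ 8 := by
    rw [← Real.exp_one_rpow, Real.rpow_ofNat]
    nlinarith [Real.exp_one_lt_d9, Real.exp_pos 1]
  have n_gt : (16 : ℝ) < n := by exact_mod_cast hn
  have m_le : (m : ℝ) ≤ n ^ 5 := by exact_mod_cast hm
  have n_le : (n : ℝ) ≤ n ^ 5 := le_self_pow₀ (by linarith) (by norm_num)
  calc Real.exp 2 * n * (n + m) ≤ 8 * n * (n ^ 5 + n ^ 5) := by gcongr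
    _ = 16 * (n : ℝ) ^ 6 := by ring
    _ < n * (n : ℝ) ^ 6 := by gcongr
    _ = (n : ℝ) ^ 7 := by ring

lemma eventually_mul_pow_ceil_log_lt {β : ℕ → ℝ} (hβ₀ : ∀ n, 0 ≤ β n)
    (hβ : Tendsto β atTop (𝓝 0)) (hm : ∀ᶠ n in atTop, m n ≤ n ^ 5) (a : ℝ) :
    ∀ᶠ n : ℕ in atTop,
      Real.exp 2 * n * (n + m n) * β n ^ ⌈Real.log n⌉₊ < (n : ℝ) ^ (-a) := by
  filter_upwards [eventually_pow_ceil_log_le hβ₀ hβ (a + 7), hm, eventually_gt_atTop 16]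
    with n pow_le m_le n_gt
  have n_pos : (0 : ℝ) < n := by positivity
  calc Real.exp 2 * n * (n + m n) * β n ^ ⌈Real.log n⌉₊
      ≤ Real.exp 2 * n * (n + m n) * (n : ℝ) ^ (-(a + 7)) := by gcongr
    _ < (n : ℝ) ^ 7 * (n : ℝ) ^ (-(a + 7)) := by
        gcongr
        exact exp_two_mul_lt_pow_seven n_gt m_le
    _ = (n : ℝ) ^ (-a) := by
        rw [← Real.rpow_natCast, ← Real.rpow_add n_pos]
        congr 1
        push_cast
        ring

lemma one_div_le_rpow_one_div_four {n m : ℕ} (hm : m ≠ 0) (hmn : m ≤ n ^ 5) :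
    1 / (n : ℝ) ≤ ((n : ℝ) / m) ^ (1 / 4 : ℝ) := by
  have m_pos : (0 : ℝ) < m := by exact_mod_cast hm.bot_lt
  have n_pos : (0 : ℝ) < n := by
    exact_mod_cast Nat.pos_of_ne_zero fun h => hm (by simpa [h] using hmn)
  have pow_le : (1 / (n : ℝ)) ^ (4 : ℝ) ≤ n / m := by
    rw [Real.rpow_ofNat, div_pow, one_pow, div_le_div_iff₀ (by positivity) m_pos, one_mul,
      ← pow_succ']
    exact_mod_cast hmn
  calc 1 / (n : ℝ) = ((1 / (n : ℝ)) ^ (4 : ℝ)) ^ (1 / 4 : ℝ) := by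
        rw [← Real.rpow_mul (by positivity)]
        norm_num
    _ ≤ _ := by gcongr

lemma eventually_le_pow_five_of_isBigO {k : ℝ}
    (hm : (fun n => (m n : ℝ)) =O[atTop] fun n : ℕ => (n : ℝ) * Real.log n ^ k) :
    ∀ᶠ n in atTop, m n ≤ n ^ 5 := by
  have log_isLittleO : (fun n : ℕ => Real.log n ^ k) =o[atTop] fun n : ℕ => (n : ℝ) := by
    simpa only [Real.rpow_one, Function.comp_def] using
      (isLittleO_log_rpow_rpow_atTop k one_pos).comp_tendsto tendsto_natCast_atTop_atTop
  have isLittleO := hm.trans_isLittleO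
    ((isBigO_refl (fun n : ℕ => (n : ℝ)) atTop).mul_isLittleO log_isLittleO)
  filter_upwards [isLittleO.bound one_pos, eventually_gt_atTop 0] with n bound n_pos
  have m_le : m n ≤ n ^ 2 := by
    rw [← Nat.cast_le (α := ℝ)]
    simpa [pow_two] using bound
  exact m_le.trans (Nat.pow_le_pow_right n_pos (by norm_num))

end Asymptotics

section HighProbability

variable {c₀ c₁ Δ : ℝ} {n m : ℕ}

lemma law_real_specNorm_deviation_le_eq_one_sub (D : Measure I) [IsProbabilityMeasure D] (r : ℝ) :
    (law c₀ c₁ Δ D n m).real {ω | specNorm (deviation c₀ c₁ Δ D ω.1.1 ω.2) ≤ r} =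
      1 - (law c₀ c₁ Δ D n m).real {ω | r < specNorm (deviation c₀ c₁ Δ D ω.1.1 ω.2)} := by
  rw [← probReal_compl_eq_one_sub
    (measurableSet_lt measurable_const (measurable_specNorm_deviation D))]
  simp only [Set.compl_ofPred, not_lt]

lemma law_real_two_mul_rpow_lt_specNorm_deviation_le (h₀ : 0 < c₀) (h₁ : c₀ ≤ c₁) (D : Measure I)
    [IsProbabilityMeasure D] (hn : n ≠ 0) (hnm : n ≤ m) (hmn : m ≤ n ^ 5) {p : ℕ} (hp : p ≠ 0) :
    (law c₀ c₁ Δ D n m).real {ω | 2 * ((n : ℝ) / m) ^ (1 / 4 : ℝ) <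
      specNorm (deviation c₀ c₁ Δ D ω.1.1 ω.2)} ≤
      Real.exp 2 * n * (n + m) * (216 * (p ^ 4 * √(n / m))) ^ p := by
  have n_pos : 0 < n := hn.bot_lt
  have m_pos : 0 < m := n_pos.trans_le hnm
  set t : ℝ := ((n : ℝ) / m) ^ (1 / 4 : ℝ)
  have t_pos : 0 < t := by positivity
  have sq_t : t ^ 2 = √(n / m) := by
    rw [Real.sqrt_eq_rpow, ← Real.rpow_mul_natCast (by positivity)]
    norm_num
  have add_le : t + 1 / n ≤ 2 * t := by
    rw [two_mul]
    gcongr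
    exact one_div_le_rpow_one_div_four m_pos.ne' hmn
  have base_eq : 216 * (p : ℝ) ^ 4 * (n / m) / t ^ 2 = 216 * (p ^ 4 * √(n / m)) := by
    rw [sq_t, mul_div_assoc, Real.div_sqrt, mul_assoc]
  have subset : {ω : ((Fin n → I) × (Fin m → I)) × (Fin m → Fin n → Bool) |
      2 * t < specNorm (deviation c₀ c₁ Δ D ω.1.1 ω.2)} ⊆
      {ω | t + 1 / n < specNorm (deviation c₀ c₁ Δ D ω.1.1 ω.2)} := fun ω hω =>
    add_le.trans_lt hω
  refine (measureReal_mono subset).trans ?_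
  simpa only [base_eq] using law_real_lt_specNorm_deviation_le (Δ := Δ) h₀ h₁ D hn hnm hp t_pos

end HighProbability

end BipartiteModel

open BipartiteModel Asymptotics Filter in
theorem mainTheorem7_general {c₀ c₁ Δ : ℝ} (h₀ : 0 < c₀) (h₁ : c₀ ≤ c₁) (D : Measure I)
    [IsProbabilityMeasure D] {c : ℝ} (hc : 8 < c) {m : ℕ → ℕ}
    (hm : (fun n : ℕ => (n : ℝ) * Real.log n ^ c) =O[atTop] fun n => (m n : ℝ))
    (hm5 : ∀ᶠ n in atTop, m n ≤ n ^ 5) (a : ℝ) :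
    ∀ᶠ n : ℕ in atTop, 1 - (n : ℝ) ^ (-a) < (law c₀ c₁ Δ D n (m n)).real
      {ω | specNorm (((n : ℝ) / (m n : ℝ)) • coMatrix ω.2 -
          (1 / (n : ℝ)) • gramMatrix c₀ c₁ Δ D ω.1.1) ≤
        2 * ((n : ℝ) / (m n : ℝ)) ^ (1 / 4 : ℝ)} := by
  have base_tendsto := (tendsto_ceil_log_pow_mul_sqrt_div hc hm).const_mul 216
  rw [mul_zero] at base_tendsto
  have tail_lt := eventually_mul_pow_ceil_log_lt (fun n => by positivity) base_tendsto hm5 a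
  filter_upwards [tail_lt, hm5, eventually_le_of_isBigO (by linarith) hm, eventually_gt_atTop 1]
    with n tail_lt m_le le_m n_gt
  have ceil_ne_zero : ⌈Real.log n⌉₊ ≠ 0 :=
    (Nat.ceil_pos.2 (Real.log_pos (by exact_mod_cast n_gt))).ne'
  refine lt_of_lt_of_eq ?_ (law_real_specNorm_deviation_le_eq_one_sub D _).symm
  exact sub_lt_sub_left
    ((law_real_two_mul_rpow_lt_specNorm_deviation_le h₀ h₁ D (by omega) le_m m_le
      ceil_ne_zero).trans_lt tail_lt) 1

theorem mainTheorem7 :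
    ∃ c' : ℝ, 0 < c' ∧
      ∀ (c₀ c₁ Δ : ℝ), 0 < c₀ → c₀ ≤ c₁ → 1 < Δ →
      ∀ (D : Measure unitInterval) [IsProbabilityMeasure D],
      ∃ C : ℝ, 0 < C ∧
        ∀ (c : ℝ), c' ≤ c → ∀ (m : ℕ → ℕ),
          ((fun n : ℕ => (n : ℝ) * Real.log n ^ c) =O[Filter.atTop] fun n : ℕ => (m n : ℝ)) →
          (∃ k : ℝ, (fun n : ℕ => (m n : ℝ)) =O[Filter.atTop]
            fun n : ℕ => (n : ℝ) * Real.log n ^ k) →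
          ∀ a : ℝ, ∀ᶠ n : ℕ in Filter.atTop,
            1 - (n : ℝ) ^ (-a) <
              (BipartiteModel.law c₀ c₁ Δ D n (m n)).real
                {ω | BipartiteModel.specNorm
                    (((n : ℝ) / (m n : ℝ)) • BipartiteModel.coMatrix ω.2 -
                      (1 / (n : ℝ)) • BipartiteModel.gramMatrix c₀ c₁ Δ D ω.1.1)
                  ≤ C * ((n : ℝ) / (m n : ℝ)) ^ (1 / 4 : ℝ)} := by
  refine ⟨9, by norm_num, fun c₀ c₁ Δ h₀ h₁ _ D _ => ⟨2, two_pos, fun c hc m hm ⟨k, hmk⟩ a => ?_⟩⟩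
  exact mainTheorem7_general h₀ h₁ D (by linarith) hm
    (BipartiteModel.eventually_le_pow_five_of_isBigO hmk) a
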